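/- Quantum minimum-weight triangle. Consider quantum algorithms on a word machine: a program, which is one finite text independent of the input, uses a constant number of classical registers of $w$ bits and a constant number of quantum registers of $w$ qubits. Each of the following is one step: a word operation (addition, subtraction, bitwise operation, comparison) on classical registers; the corresponding reversible operation $|a,b,z\rangle\mapsto|a,b,z\oplus f(a,b)\rangle$ on quantum registers; a Hadamard, $Z$ or $T$ gate on one qubit; a measurement of one register; an oracle query; a test; an iteration of a loop. Let $G$ be an undirected simple graph on the vertices $0,\dots,N-1$, $N\ge 1$, whose edges have integer weights in $\{-M,\dots,M\}$. The program is given $N$ and $M$, and oracle access (in superposition) to the weighted adjacency matrix $W$ of $G$: a query to the entry $(i,j)$ tells whether $ij$ is an edge, or returns the weight $W(i,j)$ of the edge $ij$. Theorem. For every $d\in\mathbb N$ there are a program and constants $\kappa,C,e$ (depending only on $d$) such that for all $N\ge1$, $M\ge 0$, every such weighted graph $G$ and every word length $w\ge\kappa(\ell(N)+\ell(M))$, where $\ell$ denotes the length in binary (so words of $O(\log N+\log M)$ bits suffice), the following holds. In every computation that occurs with positive probability, the program stops after at most $C\,N^{3/2}(1+\ln N)^{e}$ steps, that is, in $\tilde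 O(N^{1.5})$ time independently of $M$. With probability at least $1-N^{-d}$ its output is correct: if $G$ has a triangle, the output is three vertices $i,j,k$ that form a triangle of minimum total weight $W(i,j)+W(i,k)+W(k,j)$ in $G$; if $G$ has no triangle, the output says so. -/

import Mathlib

/-! ### Weighted graphs and minimum-weight triangles -/

/-- The weighted adjacency matrix of a graph on the vertices `0, …, N - 1` with integer edge
weights `wt`: the entry at `(i, j)` is the weight of the edge `ij`, and it is undefined (`none`)
if `ij` is not an edge (or if `i` or `j` is not a vertex). Values of `wt` off the edge set of `G`
are irrelevant. -/
noncomputable def weightMatrix {N : ℕ} (G : SimpleGraph (Fin N)) (wt : Sym2 (Fin N) → ℤ)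
    (i j : ℕ) : Option ℤ :=
  open Classical in
  if h : ∃ (hi : i < N) (hj : j < N), G.Adj ⟨i, hi⟩ ⟨j, hj⟩ then
    some (wt s(⟨i, h.1⟩, ⟨j, h.2.1⟩))
  else none

/-- The vertices `i, j, k` form a triangle. -/
def IsTriangle {N : ℕ} (G : SimpleGraph (Fin N)) (i j k : Fin N) : Prop :=
  G.Adj i j ∧ G.Adj i k ∧ G.Adj k j

/-- Total edge weight of the triangle on `i, j, k`. -/
def triangleWeight {N : ℕ} (wt : Sym2 (Fin N) → ℤ) (i j k : Fin N) : ℤ :=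
  wt s(i, j) + wt s(i, k) + wt s(k, j)

/-- The vertices `i, j, k` form a triangle of minimum total edge weight. -/
def IsMinWeightTriangle {N : ℕ} (G : SimpleGraph (Fin N)) (wt : Sym2 (Fin N) → ℤ)
    (i j k : Fin N) : Prop :=
  IsTriangle G i j k ∧
    ∀ i' j' k' : Fin N, IsTriangle G i' j' k' → triangleWeight wt i j k ≤ triangleWeight wt i' j' k'

/-! ### A quantum word machine with classical control

The machine has `c` classical and `q` quantum registers. Each register holds one word of `w` bits
(respectively `w` qubits). A program is one finite piece of text: it does not depend on the word
length, on the input, or on the oracle. -/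

namespace QMachine

/-- Word operations. The last two query the oracle `W`, a partial integer matrix: `edge` tells
whether the entry is defined, and `weight` returns its value. -/
inductive Op where
  | add | sub | and | or | xor
  | eq | ult | slt
  | edge | weight

/-- The value of a word operation. Truth values are the words `1` and `0`; arithmetic is modulo
`2 ^ w`; negative integers are in two's complement (`ult` and `slt` are the unsigned and the signed
comparison `<`). -/
def Op.eval {w : ℕ} (W : ℕ → ℕ → Option ℤ) : Op → BitVec w → BitVec w → BitVec w
  | .add, a, b => a + b
  | .sub, a, b => a - b
  | .and, a, b => a &&& b
  | .or, a, b => a ||| b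
  | .xor, a, b => a ^^^ b
  | .eq, a, b => if a = b then 1#w else 0#w
  | .ult, a, b => if a.toNat < b.toNat then 1#w else 0#w
  | .slt, a, b => if a.toInt < b.toInt then 1#w else 0#w
  | .edge, a, b => if (W a.toNat b.toNat).isSome then 1#w else 0#w
  | .weight, a, b => BitVec.ofInt w ((W a.toNat b.toNat).getD 0)

/-- An operand: a register or a literal constant. -/
inductive Operand (ι : Type) where
  | reg (i : ι)
  | lit (n : ℕ)

def Operand.eval {ι : Type} {w : ℕ} (v : ι → BitVec w) : Operand ι → BitVec w
  | .reg i => v i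
  | .lit n => BitVec.ofNat w n

/-- Single-qubit gates: the Hadamard gate, the Pauli `Z` gate and the `T` gate. -/
inductive Gate where
  | H | Z | T

/-- The unitary matrix of a single-qubit gate. -/
noncomputable def Gate.mat : Gate → Matrix (Fin 2) (Fin 2) ℂ
  | .H => ((Real.sqrt 2 : ℝ) : ℂ)⁻¹ • !![1, 1; 1, -1]
  | .Z => !![1, 0; 0, -1]
  | .T => !![1, 0; 0, Complex.exp (Complex.I * (Real.pi / 4))]

/-- Programs.
* `assign x o a b`: put `o(a, b)` into the classical register `x`; `a`, `b` are classical.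
* `gate g r i`: apply the gate `g` to qubit number `i` of the quantum register `r`.
* `qxor r o a b`: the reversible operation `|r⟩ ↦ |r ⊕ o(a, b)⟩`, where `a`, `b` are registers
  (quantum ones other than `r`, or classical ones) or constants. With `o` a query this is the usual
  quantum oracle call `|i, j, z⟩ ↦ |i, j, z ⊕ W(i, j)⟩`.
* `measure x r`: measure the quantum register `r` in the computational basis and put the outcome
  into the classical register `x`.
* `cond a P Q`: run `P` if the classical operand `a` is nonzero, and `Q` otherwise.
* `loop a P`: run `P` as often as the value of the classical operand `a` on entry tells. -/
inductive Prog (c q : ℕ) where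
  | skip
  | assign (x : Fin c) (o : Op) (a b : Operand (Fin c))
  | gate (g : Gate) (r : Fin q) (i : Operand (Fin c))
  | qxor (r : Fin q) (o : Op) (a b : Operand (Fin q ⊕ Fin c))
      (ha : a ≠ .reg (.inl r)) (hb : b ≠ .reg (.inl r))
  | measure (x : Fin c) (r : Fin q)
  | seq (P Q : Prog c q)
  | cond (a : Operand (Fin c)) (P Q : Prog c q)
  | loop (a : Operand (Fin c)) (P : Prog c q)

/-- State vectors of `q` quantum registers of `w` qubits each, in the computational basis. -/
abbrev QState (w q : ℕ) : Type := (Fin q → BitVec w) → ℂ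

/-- A branch of a computation: contents of the classical registers, the unnormalized state vector
(its squared norm is the probability of the branch), and the number of steps taken so far. -/
structure Branch (w c q : ℕ) where
  cl : Fin c → BitVec w
  psi : QState w q
  time : ℕ

/-- The probability of a branch. -/
noncomputable def Branch.prob {w c q : ℕ} (s : Branch w c q) : ℝ :=
  ∑ x, ‖s.psi x‖ ^ 2

/-- Count one step. -/
def Branch.tick {w c q : ℕ} (s : Branch w c q) : Branch w c q :=
  { s with time := s.time + 1 }

/-- Apply a single-qubit gate to qubit `i` of the register `r` (no effect if there is no
such qubit). -/
noncomputable def applyGate {w q : ℕ} (g : Gate) (r : Fin q) (i : ℕ) (psi : QState w q) :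
    QState w q := fun x =>
  if i < w then
    let b : Fin 2 := if (x r).getLsbD i then 1 else 0
    g.mat b b * psi x + g.mat b (1 - b) * psi (Function.update x r (x r ^^^ (1#w <<< i)))
  else psi x

/-- Apply the basis permutation `x r ↦ x r ⊕ f x` (an involution, if `f` ignores `x r`). -/
def applyXor {w q : ℕ} (r : Fin q) (f : (Fin q → BitVec w) → BitVec w) (psi : QState w q) :
    QState w q := fun x =>
  psi (Function.update x r (x r ^^^ f x))

/-- Project onto the subspace in which the register `r` holds `v`. -/
def project {w q : ℕ} (r : Fin q) (v : BitVec w) (psi : QState w q) : QState w q := fun x =>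
  if x r = v then psi x else 0

/-- The branches that result from running a program with oracle `W`: a measurement splits a branch
into one branch for every outcome. Each elementary instruction, each oracle query, each test and
each loop iteration is one step. -/
noncomputable def run {w c q : ℕ} (W : ℕ → ℕ → Option ℤ) :
    Prog c q → Branch w c q → Multiset (Branch w c q)
  | .skip, s => {s.tick}
  | .assign x o a b, s =>
      {{ s.tick with cl := Function.update s.cl x (o.eval W (a.eval s.cl) (b.eval s.cl)) }}
  | .gate g r i, s => {{ s.tick with psi := applyGate g r (i.eval s.cl).toNat s.psi }}
  | .qxor r o a b _ _, s =>
      {{ s.tick with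
          psi := applyXor r
            (fun x => o.eval W (a.eval (Sum.elim x s.cl)) (b.eval (Sum.elim x s.cl))) s.psi }}
  | .measure x r, s =>
      (Finset.univ : Finset (BitVec w)).val.map fun v =>
        { s.tick with cl := Function.update s.cl x v, psi := project r v s.psi }
  | .seq P Q, s => (run W P s).bind (run W Q)
  | .cond a P Q, s => if a.eval s.cl ≠ 0#w then run W P s.tick else run W Q s.tick
  | .loop a P, s =>
      (fun S : Multiset (Branch w c q) => S.bind fun t => run W P t.tick)^[(a.eval s.cl).toNat]
        {s.tick}

/-- The initial branch: `N` and `M` are in the classical registers `0` and `1`, all other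
classical registers are `0`, and all qubits are in state `|0⟩`. -/
noncomputable def start (w c q N M : ℕ) : Branch w (c + 4) q where
  cl := fun i => if i = 0 then BitVec.ofNat w N else if i = 1 then BitVec.ofNat w M else 0#w
  psi := fun x => if x = fun _ => 0#w then 1 else 0
  time := 0

/-- The probability of an event, given all the branches of a computation. -/
noncomputable def probEvent {w c q : ℕ} (S : Multiset (Branch w c q))
    (E : Branch w c q → Prop) : ℝ :=
  open Classical in ((S.filter E).map Branch.prob).sum

/-- The output is correct. If the graph has a triangle, then register `0` is nonzero and the
registers `1`, `2`, `3` hold the vertices of a minimum-weight triangle; otherwise register `0`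
is zero, which stands for the answer "no triangle". -/
def Correct {w c q N : ℕ} (G : SimpleGraph (Fin N)) (wt : Sym2 (Fin N) → ℤ)
    (s : Branch w (c + 4) q) : Prop :=
  (s.cl 0 ≠ 0#w ∧ ∃ i j k : Fin N, IsMinWeightTriangle G wt i j k ∧
    (s.cl 1).toNat = i ∧ (s.cl 2).toNat = j ∧ (s.cl 3).toNat = k) ∨
  (s.cl 0 = 0#w ∧ ∀ i j k : Fin N, ¬ IsTriangle G i j k)

end QMachine

/-! The algorithm is minimum finding by threshold descent, with Grover search over ordered vertex
triples. Call a triple marked if it is a triangle lighter than the current threshold, and let the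
rank be the number of marked triples. Initially the threshold is `3 * M + 1`, above every triangle
weight. When a marked triple is measured, it becomes the output and its weight the threshold. Rank
zero therefore means that the output is optimal, or that there is no triangle (`Ready.correct`).

Vertices are padded to `2 * h` bits with `N ≤ 4 ^ h < 4 * N`, so there are `2 ^ (6 * h)` triples and
the Grover scale is their square root `8 ^ h = O(N ^ (3 / 2))`. One Grover iteration is a rotation
by `2θ` in the plane of states that are constant on marked and on unmarked triples, where `sin θ ^
2` is the marked fraction (`run_groverStep`, `groverAmp_eq`). As the rank is unknown, a sweep tries
the iteration numbers `2 ^ k - 1` for all `k ≤ 3 * h`. The measured angles `(2 ^ (k + 1) - 1) * θ`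
grow by a factor of at most three, so they cannot jump over `[π / 4, 3π / 4]`, and some attempt
succeeds with probability at least one half if the rank has not changed before
(`exists_half_le_sin_sq`). No random choice of the iteration number is needed.

A measured marked triple is uniform among the marked ones, so the expected new rank is at most half
the old one (`two_mul_sum_rank_le`). Hence a sweep multiplies the expected rank by at most `3 / 4`
(`contracts_sweep`). With `D = 3 * (d + 3)`, after `2 * h * D` sweeps the expected rank, initially
at most `N ^ 3`, is at most `1 / N ^ d`; by Markov's inequality this bounds the failure probability.
Expectations are sums over branches of probability times rank, which compose along loops
(`Contracts.loop`).

The time bound holds on every branch: iteration numbers in a sweep form a geometric series, so a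
sweep costs `O(8 ^ h * (h + 1))` steps, and the number of sweeps is logarithmic in `N`. -/

namespace QMachine

/-! ### Loops, branches and expectations over branches -/

section Semantics

variable {w c q : ℕ} {W : ℕ → ℕ → Option ℤ}

/-- The branches after `n` iterations of a loop with body `P`. -/
noncomputable def iterRun (W : ℕ → ℕ → Option ℤ) (P : Prog c q) :
    ℕ → Branch w c q → Multiset (Branch w c q)
  | 0, s => {s}
  | n + 1, s => (run W P s.tick).bind (iterRun W P n)

theorem run_loop (a : Operand (Fin c)) (P : Prog c q) (s : Branch w c q) :
    run W (.loop a P) s = iterRun W P (a.eval s.cl).toNat s.tick := by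
  have key : ∀ (n : ℕ) (S : Multiset (Branch w c q)),
      (fun S : Multiset (Branch w c q) => S.bind fun t => run W P t.tick)^[n] S =
        S.bind (iterRun W P n) := by
    intro n
    induction n with
    | zero => intro S; simpa [iterRun] using (Multiset.bind_singleton S id).symm
    | succ n ih =>
      intro S
      rw [Function.iterate_succ_apply, ih, Multiset.bind_assoc]
      rfl
  rw [run, key, Multiset.singleton_bind]

theorem run_seq_of_run_eq {P Q : Prog c q} {s t : Branch w c q} (h : run W P s = {t}) :
    run W (.seq P Q) s = run W Q t := by
  rw [run, h, Multiset.singleton_bind]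

theorem iterRun_of_run_eq {P : Prog c q} (n : ℕ) (g : ℕ → Branch w c q)
    (h : ∀ i < n, run W P (g i).tick = {g (i + 1)}) : iterRun W P n (g 0) = {g n} := by
  induction n generalizing g with
  | zero => rfl
  | succ n ih =>
    rw [iterRun, h 0 (by omega), Multiset.singleton_bind]
    exact ih (fun i => g (i + 1)) fun i hi => h (i + 1) (by omega)

/-- Invariant rule for a loop whose body is classical and takes constant time. -/
theorem iterRun_of_invariant {P : Prog c q} {psi : QState w q} {T : ℕ}
    (I : ℕ → (Fin c → BitVec w) → Prop) (n : ℕ)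
    (h : ∀ i < n, ∀ cl t, I i cl →
      ∃ cl', run W P ⟨cl, psi, t + 1⟩ = {⟨cl', psi, t + T⟩} ∧ I (i + 1) cl')
    {cl : Fin c → BitVec w} (t : ℕ) (h0 : I 0 cl) :
    ∃ cl', iterRun W P n ⟨cl, psi, t⟩ = {⟨cl', psi, t + n * T⟩} ∧ I n cl' := by
  induction n generalizing I cl t with
  | zero => exact ⟨cl, by simp [iterRun], h0⟩
  | succ n ih =>
    obtain ⟨cl₁, h₁, hI⟩ := h 0 (by omega) cl t h0
    obtain ⟨cl₂, h₂, hI₂⟩ := ih (fun i => I (i + 1)) (fun i hi => h (i + 1) (by omega)) (t + T) hI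
    refine ⟨cl₂, ?_, hI₂⟩
    have h₁' : run W P (Branch.tick ⟨cl, psi, t⟩) = {⟨cl₁, psi, t + T⟩} := h₁
    rw [iterRun, h₁', Multiset.singleton_bind, h₂]
    congr 2
    ring

/-- The sum of a function over all branches. -/
noncomputable def total (S : Multiset (Branch w c q)) (Φ : Branch w c q → ℝ) : ℝ :=
  (S.map Φ).sum

theorem total_singleton (s : Branch w c q) (Φ : Branch w c q → ℝ) : total {s} Φ = Φ s := by
  simp [total]

theorem total_bind (S : Multiset (Branch w c q)) (f : Branch w c q → Multiset (Branch w c q))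
    (Φ : Branch w c q → ℝ) : total (S.bind f) Φ = total S fun s => total (f s) Φ := by
  simp [total, Multiset.map_bind, Multiset.sum_bind]

theorem total_mono {S : Multiset (Branch w c q)} {Φ Ψ : Branch w c q → ℝ}
    (h : ∀ s ∈ S, Φ s ≤ Ψ s) : total S Φ ≤ total S Ψ :=
  Multiset.sum_map_le_sum_map _ _ h

theorem total_congr {S : Multiset (Branch w c q)} {Φ Ψ : Branch w c q → ℝ}
    (h : ∀ s ∈ S, Φ s = Ψ s) : total S Φ = total S Ψ := by
  unfold total
  rw [Multiset.map_congr rfl h]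

theorem total_mul_left (S : Multiset (Branch w c q)) (a : ℝ) (Φ : Branch w c q → ℝ) :
    total S (fun s => a * Φ s) = a * total S Φ :=
  Multiset.sum_map_mul_left

theorem total_sub (S : Multiset (Branch w c q)) (Φ Ψ : Branch w c q → ℝ) :
    total S (fun s => Φ s - Ψ s) = total S Φ - total S Ψ :=
  Multiset.sum_map_sub

/-- Markov's inequality in disguise: with `Φ` equal to the probability times one minus the rank,
this turns a bound on the expected rank into a bound on the probability of rank zero. -/
theorem total_le_probEvent (S : Multiset (Branch w c q)) (E : Branch w c q → Prop)
    (Φ : Branch w c q → ℝ) (h : ∀ s ∈ S, Φ s ≤ s.prob) (h' : ∀ s ∈ S, ¬ E s → Φ s ≤ 0) :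
    total S Φ ≤ probEvent S E := by
  classical
  unfold total probEvent
  induction S using Multiset.induction_on with
  | empty => simp
  | cons a S ih =>
    have ih := ih (fun s hs => h s (Multiset.mem_cons_of_mem hs))
      (fun s hs => h' s (Multiset.mem_cons_of_mem hs))
    have h1 := h a (Multiset.mem_cons_self a S)
    have h2 := h' a (Multiset.mem_cons_self a S)
    by_cases hE : E a
    · simp only [Multiset.map_cons, Multiset.sum_cons, Multiset.filter_cons_of_pos _ hE]
      linarith
    · simp only [Multiset.map_cons, Multiset.sum_cons, Multiset.filter_cons_of_neg _ hE]
      linarith [h2 hE]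

end Semantics

/-! ### Hadamard gates and uniform superpositions -/

section Hadamard

variable {w q : ℕ}

/-- Flip bit number `i` of the register `r`. -/
def flip (r : Fin q) (i : ℕ) (x : Fin q → BitVec w) : Fin q → BitVec w :=
  Function.update x r (x r ^^^ (1#w <<< i))

theorem flip_flip (r : Fin q) (i : ℕ) (x : Fin q → BitVec w) : flip r i (flip r i x) = x := by
  simp [flip]

theorem flip_of_ne {r s : Fin q} (h : s ≠ r) (i : ℕ) (x : Fin q → BitVec w) :
    flip r i x s = x s := by
  simp [flip, h]

theorem getLsbD_flip (r : Fin q) {i : ℕ} (hi : i < w) (x : Fin q → BitVec w) :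
    (flip r i x r).getLsbD i = !(x r).getLsbD i := by
  simp [flip, hi]

/-- The equivalence given by flipping a bit. -/
def flipEquiv (r : Fin q) (i : ℕ) : Equiv.Perm (Fin q → BitVec w) :=
  ⟨flip r i, flip r i, flip_flip r i, flip_flip r i⟩

theorem inv_sqrt_two_mul_self : ((Real.sqrt 2 : ℝ) : ℂ)⁻¹ * ((Real.sqrt 2 : ℝ) : ℂ)⁻¹ = 1 / 2 := by
  rw [← mul_inv, ← Complex.ofReal_mul, Real.mul_self_sqrt (by norm_num)]
  norm_num

theorem applyGate_H {i : ℕ} (hi : i < w) (r : Fin q) (psi : QState w q) (x : Fin q → BitVec w) :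
    applyGate .H r i psi x = ((Real.sqrt 2 : ℝ) : ℂ)⁻¹ *
      ((if (x r).getLsbD i then -1 else 1) * psi x + psi (flip r i x)) := by
  unfold applyGate
  rw [if_pos hi]
  cases h : (x r).getLsbD i <;> simp [Gate.mat, flip] <;> ring

theorem applyGate_of_le {i : ℕ} (hi : w ≤ i) (g : Gate) (r : Fin q) (psi : QState w q) :
    applyGate g r i psi = psi := by
  funext x
  simp [applyGate, not_lt.2 hi]

theorem applyGate_Z {i : ℕ} (hi : i < w) (r : Fin q) (psi : QState w q) :
    applyGate .Z r i psi = fun x => (if (x r).getLsbD i then -1 else 1) * psi x := by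
  funext x
  unfold applyGate
  rw [if_pos hi]
  cases h : (x r).getLsbD i <;> simp [Gate.mat]

theorem applyGate_H_H (r : Fin q) (i : ℕ) (psi : QState w q) :
    applyGate .H r i (applyGate .H r i psi) = psi := by
  rcases le_or_gt w i with hi | hi
  · simp [applyGate_of_le hi]
  funext x
  rw [applyGate_H hi, applyGate_H hi, applyGate_H hi, getLsbD_flip r hi, flip_flip]
  have h2 := inv_sqrt_two_mul_self
  cases h : (x r).getLsbD i <;> simp <;> linear_combination (2 * psi x) * h2

theorem applyGate_H_add_smul (r : Fin q) (i : ℕ) (a : ℂ) (phi psi : QState w q) :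
    applyGate .H r i (phi + a • psi) = applyGate .H r i phi + a • applyGate .H r i psi := by
  rcases le_or_gt w i with hi | hi
  · simp [applyGate_of_le hi]
  funext x
  simp only [applyGate_H hi, Pi.add_apply, Pi.smul_apply, smul_eq_mul]
  ring

theorem sum_mul_applyGate_H (r : Fin q) (i : ℕ) (phi psi : QState w q) :
    ∑ x, phi x * applyGate .H r i psi x = ∑ x, applyGate .H r i phi x * psi x := by
  rcases le_or_gt w i with hi | hi
  · simp [applyGate_of_le hi]
  have h : ∑ x, phi x * psi (flip r i x) = ∑ x, phi (flip r i x) * psi x := by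
    refine Fintype.sum_equiv (flipEquiv r i) _ _ fun x => ?_
    simp [flipEquiv, flip_flip]
  have h1 : ∀ x, phi x * applyGate .H r i psi x =
      ((Real.sqrt 2 : ℝ) : ℂ)⁻¹ * ((if (x r).getLsbD i then -1 else 1) * phi x * psi x) +
        ((Real.sqrt 2 : ℝ) : ℂ)⁻¹ * (phi x * psi (flip r i x)) := by
    intro x; rw [applyGate_H hi]; ring
  have h2 : ∀ x, applyGate .H r i phi x * psi x =
      ((Real.sqrt 2 : ℝ) : ℂ)⁻¹ * ((if (x r).getLsbD i then -1 else 1) * phi x * psi x) +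
        ((Real.sqrt 2 : ℝ) : ℂ)⁻¹ * (phi (flip r i x) * psi x) := by
    intro x; rw [applyGate_H hi]; ring
  simp only [h1, h2, Finset.sum_add_distrib, ← Finset.mul_sum, h]

/-- The basis states in which register `r` holds a number below `2 ^ τ r`, for every `r`. -/
def Box (τ : Fin q → ℕ) (x : Fin q → BitVec w) : Prop := ∀ r, (x r).toNat < 2 ^ τ r

open Classical in
/-- The uniform superposition of the basis states in `Box τ`. -/
noncomputable def uniform (τ : Fin q → ℕ) : QState w q := fun x =>
  if Box τ x then ((Real.sqrt 2 : ℝ) : ℂ)⁻¹ ^ (∑ r, τ r) else 0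

theorem box_update_iff (τ : Fin q → ℕ) (r : Fin q) (n : ℕ) (x : Fin q → BitVec w) :
    Box (Function.update τ r n) x ↔ (x r).toNat < 2 ^ n ∧ ∀ s, s ≠ r → (x s).toNat < 2 ^ τ s := by
  constructor
  · intro h
    refine ⟨by simpa using h r, fun s hs => by simpa [hs] using h s⟩
  · rintro ⟨h1, h2⟩ s
    by_cases hs : s = r
    · subst hs; simpa using h1
    · simpa [hs] using h2 s hs

theorem box_iff (τ : Fin q → ℕ) (r : Fin q) (x : Fin q → BitVec w) :
    Box τ x ↔ (x r).toNat < 2 ^ τ r ∧ ∀ s, s ≠ r → (x s).toNat < 2 ^ τ s := by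
  rw [← box_update_iff, Function.update_eq_self]

theorem lt_two_pow_iff_shiftRight (X i : ℕ) : X < 2 ^ i ↔ X >>> i = 0 := by
  rw [Nat.shiftRight_eq_div_pow, Nat.div_eq_zero_iff]
  have := Nat.two_pow_pos i
  omega

/-- The first qubit above the box is still zero, so a Hadamard gate on it doubles the box and
divides the amplitude by the square root of two. -/
theorem applyGate_H_uniform (τ : Fin q → ℕ) (r : Fin q) (h : τ r < w) :
    applyGate .H r (τ r) (uniform (w := w) τ) = uniform (Function.update τ r (τ r + 1)) := by
  funext x
  have hsum : ∑ s, Function.update τ r (τ r + 1) s = ∑ s, τ s + 1 := by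
    rw [Finset.sum_update_of_mem (Finset.mem_univ r), ← Finset.add_sum_erase _ τ (Finset.mem_univ r),
      Finset.sdiff_singleton_eq_erase]
    ring
  rw [applyGate_H h]
  unfold uniform
  rw [hsum, box_update_iff, box_iff τ r x, box_iff τ r (flip r (τ r) x)]
  have hne : (∀ s, s ≠ r → (flip r (τ r) x s).toNat < 2 ^ τ s) ↔
      ∀ s, s ≠ r → (x s).toNat < 2 ^ τ s :=
    forall₂_congr fun s hs => by rw [flip_of_ne hs]
  rw [hne]
  by_cases hB : ∀ s, s ≠ r → (x s).toNat < 2 ^ τ s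
  swap
  · simp [hB]
  have hflip : (flip r (τ r) x r).toNat = (x r).toNat ^^^ 2 ^ τ r := by
    have : 2 ^ τ r < 2 ^ w := Nat.pow_lt_pow_right (by norm_num) h
    simp [flip, Nat.shiftLeft_eq, Nat.mod_eq_of_lt this, BitVec.toNat_one (by omega : 0 < w)]
  have hX : (x r).toNat < 2 ^ (τ r + 1) ↔ (x r).toNat >>> τ r < 2 := by
    rw [Nat.shiftRight_eq_div_pow, Nat.div_lt_iff_lt_mul (Nat.two_pow_pos _), pow_succ, mul_comm]
  have hb : (x r).getLsbD (τ r) = decide ((x r).toNat >>> τ r % 2 = 1) := by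
    rw [BitVec.getLsbD, Nat.testBit_eq_decide_div_mod_eq, Nat.shiftRight_eq_div_pow]
  have hone : 2 ^ τ r >>> τ r = 1 := by
    rw [Nat.shiftRight_eq_div_pow, Nat.div_self (Nat.two_pow_pos _)]
  have hF : (flip r (τ r) x r).toNat < 2 ^ τ r ↔ (x r).toNat >>> τ r = 1 := by
    rw [hflip, lt_two_pow_iff_shiftRight, Nat.shiftRight_xor_distrib, hone, Nat.xor_eq_zero_iff]
  rw [lt_two_pow_iff_shiftRight, hF, hX, hb]
  -- Only the quotient `Y` of the register by `2 ^ τ r` matters now: `Y = 0` is the old box, `Y = 1`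
  -- is fed by the flipped basis state, and `2 ≤ Y` lies outside both boxes.
  generalize (x r).toNat >>> τ r = Y
  have : Y = 0 ∨ Y = 1 ∨ 2 ≤ Y := by omega
  rcases this with rfl | rfl | hY
  · simp [pow_succ, mul_comm]
  · simp [pow_succ, mul_comm]
  · have h0 : Y ≠ 0 := by omega
    have h1 : Y ≠ 1 := by omega
    simp [h0, h1, not_lt.2 hY]

end Hadamard

/-! ### The program -/

section Programs

/-! The classical registers of the program:
* `0`: whether a triangle has been found; `1`, `2`, `3`: its vertices;
* `4`: the threshold, which is the weight of that triangle, or `3 * M + 1`;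
* `5`: the number of qubits that hold a vertex; `6`: the number of Grover runs in a sweep;
* `7`: index of a qubit; `8`: the number of Grover iterations;
* `9`, `10`, `11`: measured vertices; `12`, `13`, `14`: scratch.

The quantum registers `0`, `1`, `2` hold vertices, the other ones are scratch and are always
restored to zero. -/

/-- A quantum register as an operand. -/
abbrev qr (r : Fin 15) : Operand (Fin 15 ⊕ Fin 16) := .reg (.inl r)

/-- A classical register as an operand of a quantum operation. -/
abbrev qcl (r : Fin 16) : Operand (Fin 15 ⊕ Fin 16) := .reg (.inr r)

/-- Run `X`, `P`, `X`. -/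
abbrev Prog.sandwich (X P : Prog 16 15) : Prog 16 15 := .seq X (.seq P X)

/-- Change the sign of the triangles that are lighter than the threshold. -/
def phaseOracle : Prog 16 15 :=
  .sandwich (.qxor 3 .edge (qr 0) (qr 1) (by simp) (by simp)) <|
  .sandwich (.qxor 4 .edge (qr 0) (qr 2) (by simp) (by simp)) <|
  .sandwich (.qxor 5 .edge (qr 2) (qr 1) (by simp) (by simp)) <|
  .sandwich (.qxor 6 .weight (qr 0) (qr 1) (by simp) (by simp)) <|
  .sandwich (.qxor 7 .weight (qr 0) (qr 2) (by simp) (by simp)) <|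
  .sandwich (.qxor 8 .weight (qr 2) (qr 1) (by simp) (by simp)) <|
  .sandwich (.qxor 9 .add (qr 6) (qr 7) (by simp) (by simp)) <|
  .sandwich (.qxor 10 .add (qr 9) (qr 8) (by simp) (by simp)) <|
  .sandwich (.qxor 11 .slt (qr 10) (qcl 4) (by simp) (by simp)) <|
  .sandwich (.qxor 12 .and (qr 3) (qr 4) (by simp) (by simp)) <|
  .sandwich (.qxor 13 .and (qr 5) (qr 11) (by simp) (by simp)) <|
  .sandwich (.qxor 14 .and (qr 12) (qr 13) (by simp) (by simp)) <|
  .gate .Z 14 (.lit 0)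

/-- Change the sign of the zero state. -/
def phaseZero : Prog 16 15 :=
  .sandwich (.qxor 3 .or (qr 0) (qr 1) (by simp) (by simp)) <|
  .sandwich (.qxor 4 .or (qr 3) (qr 2) (by simp) (by simp)) <|
  .sandwich (.qxor 5 .eq (qr 4) (.lit 0) (by simp) (by simp)) <|
  .gate .Z 5 (.lit 0)

/-- Hadamard gates on the qubits that hold vertices. -/
def hadamards : Prog 16 15 :=
  .loop (.reg 5) <|
    .seq (.gate .H 0 (.reg 7)) <| .seq (.gate .H 1 (.reg 7)) <| .seq (.gate .H 2 (.reg 7)) <|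
      .assign 7 .add (.reg 7) (.lit 1)

/-- The same Hadamard gates in reverse order. -/
def hadamardsRev : Prog 16 15 :=
  .loop (.reg 5) <|
    .seq (.assign 7 .sub (.reg 7) (.lit 1)) <|
      .seq (.gate .H 2 (.reg 7)) <| .seq (.gate .H 1 (.reg 7)) (.gate .H 0 (.reg 7))

/-- One Grover iteration. -/
def groverStep : Prog 16 15 :=
  .seq phaseOracle <| .seq hadamardsRev <| .seq phaseZero hadamards

/-- Check whether the measured vertices form a triangle that is lighter than the threshold. If so,
keep it. Both branches of the test take equally many steps. -/
def classicalCheck : Prog 16 15 :=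
  .seq (.assign 12 .edge (.reg 9) (.reg 10)) <|
  .seq (.assign 13 .edge (.reg 9) (.reg 11)) <|
  .seq (.assign 12 .and (.reg 12) (.reg 13)) <|
  .seq (.assign 13 .edge (.reg 11) (.reg 10)) <|
  .seq (.assign 12 .and (.reg 12) (.reg 13)) <|
  .seq (.assign 13 .weight (.reg 9) (.reg 10)) <|
  .seq (.assign 14 .weight (.reg 9) (.reg 11)) <|
  .seq (.assign 13 .add (.reg 13) (.reg 14)) <|
  .seq (.assign 14 .weight (.reg 11) (.reg 10)) <|
  .seq (.assign 13 .add (.reg 13) (.reg 14)) <|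
  .seq (.assign 14 .slt (.reg 13) (.reg 4)) <|
  .seq (.assign 12 .and (.reg 12) (.reg 14)) <|
  .cond (.reg 12)
    (.seq (.assign 0 .add (.lit 1) (.lit 0)) <|
      .seq (.assign 1 .add (.reg 9) (.lit 0)) <|
      .seq (.assign 2 .add (.reg 10) (.lit 0)) <|
      .seq (.assign 3 .add (.reg 11) (.lit 0)) <|
      .assign 4 .add (.reg 13) (.lit 0))
    (.seq .skip <| .seq .skip <| .seq .skip <| .seq .skip .skip)

/-- Measure the vertices. -/
def measureVertices : Prog 16 15 :=
  .seq (.measure 9 0) <| .seq (.measure 10 1) (.measure 11 2)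

/-- Clear the measured quantum registers. -/
def clearRegisters : Prog 16 15 :=
  .seq (.qxor 0 .add (qcl 9) (.lit 0) (by simp) (by simp)) <|
  .seq (.qxor 1 .add (qcl 10) (.lit 0) (by simp) (by simp)) <|
  .seq (.qxor 2 .add (qcl 11) (.lit 0) (by simp) (by simp)) <|
  .assign 7 .add (.lit 0) (.lit 0)

/-- Prepare the state by Grover iterations, measure it, and keep the outcome if it is better. -/
def attempt : Prog 16 15 :=
  .seq hadamards <| .seq (.loop (.reg 8) groverStep) <|
    .seq measureVertices <| .seq clearRegisters classicalCheck

/-- An attempt, and the next number of Grover iterations. -/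
def sweepBody : Prog 16 15 :=
  .seq attempt <| .seq (.assign 8 .add (.reg 8) (.reg 8)) (.assign 8 .add (.reg 8) (.lit 1))

/-- Attempts with `2 ^ k - 1` Grover iterations for `k = 0, 1, …`. -/
def sweep : Prog 16 15 :=
  .seq (.assign 8 .add (.lit 0) (.lit 0)) (.loop (.reg 6) sweepBody)

/-- Register `12` holds a power of four. If it is below register `0`, pass to the next power. Both
branches of the test take equally many steps. -/
def setupBody : Prog 16 15 :=
  .seq (.assign 13 .ult (.reg 12) (.reg 0)) <|
  .cond (.reg 13)
    (.seq (.assign 12 .add (.reg 12) (.reg 12)) <|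
      .seq (.assign 12 .add (.reg 12) (.reg 12)) <|
      .seq (.assign 5 .add (.reg 5) (.lit 2)) (.assign 6 .add (.reg 6) (.lit 3)))
    (.seq .skip <| .seq .skip <| .seq .skip .skip)

/-- Determine the number of qubits, the length of a sweep, and the first threshold. -/
def setup : Prog 16 15 :=
  .seq (.assign 12 .add (.lit 1) (.lit 0)) <|
  .seq (.assign 6 .add (.lit 1) (.lit 0)) <|
  .seq (.loop (.reg 0) setupBody) <|
  .seq (.assign 4 .add (.reg 1) (.reg 1)) <|
  .seq (.assign 4 .add (.reg 4) (.reg 1)) <|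
  .seq (.assign 4 .add (.reg 4) (.lit 1)) (.assign 0 .add (.lit 0) (.lit 0))

/-- Find a triangle of minimum weight. -/
def minTriangle (D : ℕ) : Prog 16 15 :=
  .seq setup (.loop (.lit D) (.loop (.reg 5) sweep))

end Programs

/-! ### Phase oracles by computing and uncomputing -/

section Phases

variable {w : ℕ} {W : ℕ → ℕ → Option ℤ}

/-- The program multiplies the amplitude of every basis state `x` by `f x`, in `T` steps. -/
def IsPhase (W : ℕ → ℕ → Option ℤ) (P : Prog 16 15) (cl : Fin 16 → BitVec w)
    (f : (Fin 15 → BitVec w) → ℂ) (T : ℕ) : Prop :=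
  ∀ psi t, run W P ⟨cl, psi, t⟩ = {⟨cl, fun x => f x * psi x, t + T⟩}

/-- The action of `qxor` on basis states. -/
def xorMap (W : ℕ → ℕ → Option ℤ) (cl : Fin 16 → BitVec w) (r : Fin 15) (o : Op)
    (a b : Operand (Fin 15 ⊕ Fin 16)) (x : Fin 15 → BitVec w) : Fin 15 → BitVec w :=
  Function.update x r (x r ^^^ o.eval W (a.eval (Sum.elim x cl)) (b.eval (Sum.elim x cl)))

theorem Operand.eval_update {cl : Fin 16 → BitVec w} {r : Fin 15}
    {a : Operand (Fin 15 ⊕ Fin 16)} (ha : a ≠ .reg (.inl r)) (x : Fin 15 → BitVec w)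
    (v : BitVec w) :
    a.eval (Sum.elim (Function.update x r v) cl) = a.eval (Sum.elim x cl) := by
  rcases a with (s | s) | n
  · have : s ≠ r := fun h => ha (by rw [h])
    simp [Operand.eval, this]
  · rfl
  · rfl

theorem xorMap_xorMap {cl : Fin 16 → BitVec w} {r : Fin 15} {o : Op}
    {a b : Operand (Fin 15 ⊕ Fin 16)} (ha : a ≠ .reg (.inl r)) (hb : b ≠ .reg (.inl r))
    (x : Fin 15 → BitVec w) : xorMap W cl r o a b (xorMap W cl r o a b x) = x := by
  unfold xorMap
  rw [Operand.eval_update ha, Operand.eval_update hb]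
  simp

/-- Conjugating a diagonal operator by a basis permutation gives a diagonal operator. Since `xorMap`
is an involution, the second `qxor` uncomputes the first, so nested computations need no separate
cleanup argument. -/
theorem IsPhase.sandwich {P : Prog 16 15} {cl : Fin 16 → BitVec w}
    {f : (Fin 15 → BitVec w) → ℂ} {T : ℕ} (h : IsPhase W P cl f T) {r : Fin 15} {o : Op}
    {a b : Operand (Fin 15 ⊕ Fin 16)} (ha : a ≠ .reg (.inl r)) (hb : b ≠ .reg (.inl r)) :
    IsPhase W (.sandwich (.qxor r o a b ha hb) P) cl (f ∘ xorMap W cl r o a b) (T + 2) := by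
  intro psi t
  have hx : ∀ psi t, run W (.qxor r o a b ha hb) ⟨cl, psi, t⟩ =
      {⟨cl, psi ∘ xorMap W cl r o a b, t + 1⟩} := fun _ _ => rfl
  rw [run_seq_of_run_eq (hx psi t), run_seq_of_run_eq (h _ _), hx]
  congr 2
  · funext x
    simp [Function.comp, xorMap_xorMap ha hb]
  · ring

theorem isPhase_Z (hw : 0 < w) (r : Fin 15) (cl : Fin 16 → BitVec w) :
    IsPhase W (.gate .Z r (.lit 0)) cl (fun x => if (x r).getLsbD 0 then -1 else 1) 1 := by
  intro psi t
  simp [run, Branch.tick, Operand.eval, applyGate_Z hw]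

open Classical in
/-- The truth value of a proposition, as a word. -/
noncomputable def flag (w : ℕ) (p : Prop) : BitVec w := if p then 1#w else 0#w

theorem flag_and_flag (p q : Prop) : flag w p &&& flag w q = flag w (p ∧ q) := by
  by_cases hp : p <;> by_cases hq : q <;> simp [hp, hq, flag]

theorem getLsbD_flag (hw : 0 < w) (p : Prop) : (flag w p).getLsbD 0 = true ↔ p := by
  by_cases hp : p <;> simp [hp, hw, flag]

theorem eval_edge (a b : BitVec w) :
    Op.edge.eval W a b = flag w ((W a.toNat b.toNat).isSome) := by
  simp only [Op.eval, flag]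
  congr

theorem eval_slt (a b : BitVec w) : Op.slt.eval W a b = flag w (a.toInt < b.toInt) := by
  simp only [Op.eval, flag]
  congr

theorem eval_and (a b : BitVec w) : Op.and.eval W a b = a &&& b := rfl

theorem eval_add (a b : BitVec w) : Op.add.eval W a b = a + b := rfl

/-- The entries of `W` on the three vertices are defined. -/
def Tri (W : ℕ → ℕ → Option ℤ) (v : BitVec w × BitVec w × BitVec w) : Prop :=
  (W v.1.toNat v.2.1.toNat).isSome ∧ (W v.1.toNat v.2.2.toNat).isSome ∧
    (W v.2.2.toNat v.2.1.toNat).isSome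

/-- The total weight of three vertices, as a word. -/
def weightWord (W : ℕ → ℕ → Option ℤ) (v : BitVec w × BitVec w × BitVec w) : BitVec w :=
  Op.weight.eval W v.1 v.2.1 + Op.weight.eval W v.1 v.2.2 + Op.weight.eval W v.2.2 v.2.1

/-- The vertices form a triangle lighter than the threshold `thr`. -/
def Marked (W : ℕ → ℕ → Option ℤ) (thr : BitVec w) (v : BitVec w × BitVec w × BitVec w) : Prop :=
  Tri W v ∧ (weightWord W v).toInt < thr.toInt

/-- All registers but the first three are zero. -/
def ScratchZero (x : Fin 15 → BitVec w) : Prop := ∀ r : Fin 15, 3 ≤ r → x r = 0#w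

-- The phase is explicit only for zero scratch registers; there each `qxor` writes its value into a
-- zero register. Twelve sandwiches of two steps each around one `Z` gate give 25 steps.
open Classical in
theorem isPhase_phaseOracle (hw : 0 < w) (cl : Fin 16 → BitVec w) :
    ∃ f, IsPhase W phaseOracle cl f 25 ∧
      ∀ x, ScratchZero x → f x = if Marked W (cl 4) (x 0, x 1, x 2) then -1 else 1 := by
  refine ⟨_, (((((((((((((isPhase_Z hw 14 cl).sandwich _ _).sandwich _ _).sandwich _ _).sandwich
    _ _).sandwich _ _).sandwich _ _).sandwich _ _).sandwich _ _).sandwich _ _).sandwich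
    _ _).sandwich _ _).sandwich _ _), ?_⟩
  intro x hx
  have h (r : Fin 15) (hr : 3 ≤ r) := hx r hr
  have h3 := h 3 (by decide)
  have h4 := h 4 (by decide)
  have h5 := h 5 (by decide)
  have h6 := h 6 (by decide)
  have h7 := h 7 (by decide)
  have h8 := h 8 (by decide)
  have h9 := h 9 (by decide)
  have h10 := h 10 (by decide)
  have h11 := h 11 (by decide)
  have h12 := h 12 (by decide)
  have h13 := h 13 (by decide)
  have h14 := h 14 (by decide)
  simp only [Function.comp_apply, xorMap, Operand.eval, Sum.elim_inl, Sum.elim_inr, ne_eq,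
    Function.update_self, Fin.reduceEq, not_false_eq_true, Function.update_of_ne,
    h3, h4, h5, h6, h7, h8, h9, h10, h11, h12, h13, h14, BitVec.zero_xor]
  simp only [eval_edge, eval_slt, eval_and, eval_add, flag_and_flag, getLsbD_flag hw, Marked, Tri,
    weightWord, and_assoc]

theorem isPhase_phaseZero (hw : 0 < w) (cl : Fin 16 → BitVec w) :
    ∃ f, IsPhase W phaseZero cl f 7 ∧
      ∀ x, ScratchZero x → f x = if x = 0 then -1 else 1 := by
  refine ⟨_, ((((isPhase_Z hw 5 cl).sandwich _ _).sandwich _ _).sandwich _ _), ?_⟩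
  intro x hx
  have h3 := hx 3 (by decide)
  have h4 := hx 4 (by decide)
  have h5 := hx 5 (by decide)
  have h0 : x = 0 ↔ (x 0 = 0#w ∧ x 1 = 0#w) ∧ x 2 = 0#w := by
    refine ⟨fun h => by simp [h], fun ⟨⟨h0, h1⟩, h2⟩ => funext fun r => ?_⟩
    by_cases hr : 3 ≤ r
    · exact hx r hr
    · have : r = 0 ∨ r = 1 ∨ r = 2 := by
        revert r; decide
      rcases this with rfl | rfl | rfl <;> assumption
  simp [xorMap, Operand.eval, h3, h4, h5, Op.eval, h0]
  by_cases h : (x 0 = 0#w ∧ x 1 = 0#w) ∧ x 2 = 0#w <;> simp [h, hw]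

end Phases

/-! ### The Hadamard transform and the diffusion operator -/

section HadamardTransform

variable {w : ℕ}

/-- Hadamard gates on qubit `i` of the three vertex registers. -/
noncomputable def hadStep (i : ℕ) (psi : QState w 15) : QState w 15 :=
  applyGate .H 2 i (applyGate .H 1 i (applyGate .H 0 i psi))

/-- The inverse of `hadStep`. -/
noncomputable def hadStepRev (i : ℕ) (psi : QState w 15) : QState w 15 :=
  applyGate .H 0 i (applyGate .H 1 i (applyGate .H 2 i psi))

/-- The Hadamard transform on `n` qubits of each of the vertex registers. -/
noncomputable def had : ℕ → QState w 15 → QState w 15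
  | 0, psi => psi
  | n + 1, psi => hadStep n (had n psi)

/-- The inverse of `had`. -/
noncomputable def hadRev : ℕ → QState w 15 → QState w 15
  | 0, psi => psi
  | n + 1, psi => hadRev n (hadStepRev n psi)

theorem had_hadRev (n : ℕ) (psi : QState w 15) : had n (hadRev n psi) = psi := by
  induction n generalizing psi with
  | zero => rfl
  | succ n ih => simp only [had, hadRev, ih, hadStep, hadStepRev, applyGate_H_H]

theorem hadRev_had (n : ℕ) (psi : QState w 15) : hadRev n (had n psi) = psi := by
  induction n with
  | zero => rfl
  | succ n ih => simp only [had, hadRev, hadStep, hadStepRev, applyGate_H_H, ih]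

/-- Hadamard gates are real symmetric, so reversing their order transposes the transform. A bilinear
pairing without conjugation therefore suffices. -/
theorem sum_mul_hadRev (n : ℕ) (phi psi : QState w 15) :
    ∑ x, phi x * hadRev n psi x = ∑ x, had n phi x * psi x := by
  induction n generalizing psi with
  | zero => rfl
  | succ n ih => simp only [had, hadRev, ih, hadStep, hadStepRev, sum_mul_applyGate_H]

theorem had_add_smul (n : ℕ) (a : ℂ) (phi psi : QState w 15) :
    had n (phi + a • psi) = had n phi + a • had n psi := by
  induction n with
  | zero => rfl
  | succ n ih => simp only [had, ih, hadStep, applyGate_H_add_smul]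

theorem had_smul (n : ℕ) (a : ℂ) (psi : QState w 15) : had n (a • psi) = a • had n psi := by
  have h0 : had n (0 : QState w 15) = 0 := by
    have := had_add_smul n 1 (0 : QState w 15) 0
    simpa using this
  simpa [h0] using had_add_smul n a 0 psi

/-- The state in which all quantum registers are zero. -/
noncomputable def zeroState : QState w 15 := fun x => if x = 0 then 1 else 0

theorem sum_zeroState_mul (psi : QState w 15) : ∑ x, zeroState x * psi x = psi 0 := by
  simp [zeroState]

/-- The vertex registers have `n` qubits each. -/
def vertexBox (n : ℕ) (r : Fin 15) : ℕ := if r < 3 then n else 0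

theorem zeroState_eq_uniform : zeroState (w := w) = uniform (vertexBox 0) := by
  funext x
  have hB : Box (vertexBox 0) x ↔ x = 0 := by
    constructor
    · intro h
      funext r
      have := h r
      simp only [vertexBox, ite_self, pow_zero, Nat.lt_one_iff] at this
      exact BitVec.eq_of_toNat_eq this
    · rintro rfl r
      simp [vertexBox]
  simp [zeroState, uniform, hB, vertexBox]

theorem had_zeroState {n : ℕ} (hn : n ≤ w) :
    had n (zeroState (w := w)) = uniform (vertexBox n) := by
  induction n with
  | zero => exact zeroState_eq_uniform
  | succ n ih =>
    have key : ∀ (τ : Fin 15 → ℕ) (r : Fin 15), τ r = n →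
        applyGate .H r n (uniform (w := w) τ) = uniform (Function.update τ r (n + 1)) := by
      rintro τ r rfl
      exact applyGate_H_uniform τ r hn
    rw [had, ih (by omega), hadStep, key _ _ (by simp [vertexBox]), key _ _ (by simp [vertexBox]),
      key _ _ (by simp [vertexBox])]
    congr 1
    funext r
    fin_cases r <;> simp [vertexBox]

theorem run_hadamards {W : ℕ → ℕ → Option ℤ} {cl : Fin 16 → BitVec w} {n : ℕ} (hn : n < 2 ^ w)
    (h7 : cl 7 = 0#w) (h5 : cl 5 = BitVec.ofNat w n) (psi : QState w 15) (t : ℕ) :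
    run W hadamards ⟨cl, psi, t⟩ =
      {⟨Function.update cl 7 (BitVec.ofNat w n), had n psi, t + 1 + 5 * n⟩} := by
  rw [hadamards, run_loop]
  have h5' : (Operand.eval cl (.reg 5)).toNat = n := by
    simp [Operand.eval, h5, Nat.mod_eq_of_lt hn]
  have := iterRun_of_run_eq (W := W) (P := .seq (.gate .H 0 (.reg 7)) <|
      .seq (.gate .H 1 (.reg 7)) <| .seq (.gate .H 2 (.reg 7)) <|
      .assign 7 .add (.reg 7) (.lit 1)) n
    (fun i => (⟨Function.update cl 7 (BitVec.ofNat w i), had i psi, t + 1 + 5 * i⟩ :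
      Branch w 16 15)) (by
      intro i hi
      have hi' : i % 2 ^ w = i := Nat.mod_eq_of_lt (by omega)
      simp only [run, Branch.tick, Operand.eval, Op.eval, Function.update_self, Multiset.singleton_bind,
        BitVec.toNat_ofNat, hi', Function.update_idem, ← BitVec.ofNat_add, had, hadStep]
      congr 2)
  rw [h5']
  rw [← this]
  congr 2
  simp [← h7]
  rfl

theorem run_hadamardsRev {W : ℕ → ℕ → Option ℤ} {cl : Fin 16 → BitVec w} {n : ℕ}
    (hn : n < 2 ^ w) (h7 : cl 7 = BitVec.ofNat w n) (h5 : cl 5 = BitVec.ofNat w n)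
    (psi : QState w 15) (t : ℕ) :
    run W hadamardsRev ⟨cl, psi, t⟩ =
      {⟨Function.update cl 7 0#w, hadRev n psi, t + 1 + 5 * n⟩} := by
  have key : ∀ (i : ℕ) (psi : QState w 15) (t : ℕ), i ≤ n →
      iterRun W (.seq (.assign 7 .sub (.reg 7) (.lit 1)) <|
        .seq (.gate .H 2 (.reg 7)) <| .seq (.gate .H 1 (.reg 7)) (.gate .H 0 (.reg 7))) i
        ⟨Function.update cl 7 (BitVec.ofNat w i), psi, t⟩ =
      {⟨Function.update cl 7 0#w, hadRev i psi, t + 5 * i⟩} := by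
    intro i
    induction i with
    | zero => intro psi t _; simp [iterRun, hadRev]
    | succ i ih =>
      intro psi t hi
      have hi' : i % 2 ^ w = i := Nat.mod_eq_of_lt (by omega)
      have hs : BitVec.ofNat w (i + 1) - BitVec.ofNat w 1 = BitVec.ofNat w i := by
        rw [BitVec.ofNat_add, BitVec.add_sub_cancel]
      simp only [iterRun, run, Branch.tick, Operand.eval, Op.eval, Function.update_self,
        Multiset.singleton_bind, Function.update_idem, hs, BitVec.toNat_ofNat, hi']
      rw [ih _ _ (by omega)]
      simp only [hadRev, hadStepRev]
      congr 2
      ring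
  have h5' : (Operand.eval cl (.reg 5)).toNat = n := by
    simp [Operand.eval, h5, Nat.mod_eq_of_lt hn]
  rw [hadamardsRev, run_loop, h5', ← key n psi (t + 1) le_rfl]
  congr 2
  simp [← h7]
  rfl

/-- The amplitudes of the basis states with nonzero scratch registers vanish. -/
def Supported (psi : QState w 15) : Prop := ∀ x, ¬ ScratchZero x → psi x = 0

theorem Supported.applyGate_H {psi : QState w 15} (h : Supported psi) {r : Fin 15} (hr : r < 3)
    (i : ℕ) : Supported (applyGate .H r i psi) := by
  intro x hx
  rcases le_or_gt w i with hi | hi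
  · rw [applyGate_of_le hi]
    exact h x hx
  have hf : ¬ ScratchZero (flip r i x) := fun hf => hx fun s hs => by
    rw [← hf s hs, flip_of_ne (hr.trans_le hs).ne']
  rw [QMachine.applyGate_H hi, h x hx, h _ hf]
  simp

theorem Supported.hadRev {psi : QState w 15} (h : Supported psi) (n : ℕ) :
    Supported (hadRev n psi) := by
  induction n generalizing psi with
  | zero => exact h
  | succ n ih =>
    exact ih (((h.applyGate_H (by decide) n).applyGate_H (by decide) n).applyGate_H (by decide) n)

/-- The diffusion operator is a reflection. -/
theorem had_mul_hadRev {n : ℕ} (hn : n ≤ w) {psi : QState w 15} (h : Supported psi)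
    {f : (Fin 15 → BitVec w) → ℂ} (hf : ∀ x, ScratchZero x → f x = if x = 0 then -1 else 1) :
    had n (fun x => f x * hadRev n psi x) =
      psi + (-2 * ∑ x, uniform (vertexBox n) x * psi x) • uniform (vertexBox n) := by
  -- On supported states the phase is the identity minus twice the projection onto the zero state.
  -- Conjugation by `had n` turns that projection into the one onto the uniform state.
  have h1 : (fun x => f x * hadRev n psi x) =
      hadRev n psi + (-2 * hadRev n psi 0) • zeroState := by
    funext x
    by_cases hx : ScratchZero x
    · rw [hf x hx]
      by_cases h0 : x = 0
      · subst h0; simp [zeroState]; ring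
      · simp [zeroState, h0]
    · have h0 : x ≠ 0 := by rintro rfl; exact hx fun _ _ => rfl
      simp [zeroState, h0, h.hadRev n x hx]
  rw [h1, had_add_smul, had_hadRev, had_zeroState hn, ← had_zeroState hn, ← sum_mul_hadRev,
    sum_zeroState_mul]

theorem sum_uniform_mul_self {n : ℕ} (hn : n ≤ w) :
    ∑ x, uniform (w := w) (vertexBox n) x * uniform (vertexBox n) x = 1 := by
  rw [← had_zeroState hn, ← sum_mul_hadRev, hadRev_had, sum_zeroState_mul]
  simp [zeroState]

end HadamardTransform

/-! ### Grover rotation in the two-dimensional invariant plane -/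

section Amplitudes

/-- The amplitudes of marked and of unmarked elements after `j` Grover iterations, if `t` out of
`S` elements are marked. Initially all amplitudes are `u`. -/
def groverAmp (S t u : ℝ) : ℕ → ℝ × ℝ
  | 0 => (u, u)
  | j + 1 =>
    let a := (groverAmp S t u j).1
    let b := (groverAmp S t u j).2
    (-a - 2 * u ^ 2 * (t * -a + (S - t) * b), b - 2 * u ^ 2 * (t * -a + (S - t) * b))

/-- An iteration composes two reflections, hence rotates by `2θ`, up to a global sign. Multiplying
by `sin θ` and `cos θ` instead of dividing also covers the cases where nothing or everything is
marked. -/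
theorem groverAmp_eq {S t u θ : ℝ} (hS : S * u ^ 2 = 1) (ht : Real.sin θ ^ 2 = t * u ^ 2) (j : ℕ) :
    (groverAmp S t u j).1 * Real.sin θ = u * (-1) ^ j * Real.sin ((2 * j + 1) * θ) ∧
      (groverAmp S t u j).2 * Real.cos θ = u * (-1) ^ j * Real.cos ((2 * j + 1) * θ) := by
  have hc : Real.cos θ ^ 2 = (S - t) * u ^ 2 := by
    linear_combination Real.sin_sq_add_cos_sq θ - ht - hS
  induction j with
  | zero => simp [groverAmp]
  | succ j ih =>
    obtain ⟨h1, h2⟩ := ih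
    have hθ : (2 * ((j + 1 : ℕ) : ℝ) + 1) * θ = (2 * j + 1) * θ + 2 * θ := by push_cast; ring
    have h11 := Real.sin_sq_add_cos_sq θ
    rw [hθ, Real.sin_add, Real.cos_add, Real.sin_two_mul, Real.cos_two_mul, groverAmp]
    set a := (groverAmp S t u j).1
    set b := (groverAmp S t u j).2
    set x := Real.sin ((2 * j + 1) * θ)
    set y := Real.cos ((2 * j + 1) * θ)
    constructor
    · linear_combination (1 - 2 * Real.cos θ ^ 2) * h1 - 2 * Real.sin θ * Real.cos θ * h2
        - 2 * a * Real.sin θ * ht + 2 * b * Real.sin θ * hc + 2 * a * Real.sin θ * h11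
    · linear_combination (1 - 2 * Real.cos θ ^ 2) * h2 + 2 * Real.sin θ * Real.cos θ * h1
        - 2 * a * Real.cos θ * ht + 2 * b * Real.cos θ * hc

theorem mul_groverAmp_sq {S t u θ : ℝ} (hS : S * u ^ 2 = 1)
    (ht : Real.sin θ ^ 2 = t * u ^ 2) (j : ℕ) :
    t * (groverAmp S t u j).1 ^ 2 = Real.sin ((2 * j + 1) * θ) ^ 2 ∧
      (S - t) * (groverAmp S t u j).2 ^ 2 = Real.cos ((2 * j + 1) * θ) ^ 2 := by
  have hc : Real.cos θ ^ 2 = (S - t) * u ^ 2 := by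
    linear_combination Real.sin_sq_add_cos_sq θ - ht - hS
  obtain ⟨h1, h2⟩ := groverAmp_eq hS ht j
  have hu : u ^ 2 ≠ 0 := by rintro h; simp [h] at hS
  have hpm : ((-1 : ℝ) ^ j) ^ 2 = 1 := by rw [← pow_mul, mul_comm, pow_mul]; simp
  have h1' := congrArg (· ^ 2) h1
  have h2' := congrArg (· ^ 2) h2
  simp only [mul_pow, hpm, mul_one] at h1' h2'
  constructor
  · apply mul_left_cancel₀ hu
    rw [← h1', ht]; ring
  · apply mul_left_cancel₀ hu
    rw [← h2', hc]; ring

theorem half_le_sin_sq {x : ℝ} (h1 : Real.pi / 4 ≤ x) (h2 : x ≤ 3 * Real.pi / 4) :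
    1 / 2 ≤ Real.sin x ^ 2 := by
  have := Real.cos_nonpos_of_pi_div_two_le_of_le (x := 2 * x) (by linarith) (by linarith)
  rw [Real.sin_sq_eq_half_sub]
  linarith

/-- One of the iteration numbers `2 ^ k - 1` succeeds with probability at least one half. -/
theorem exists_half_le_sin_sq {θ : ℝ} (h2 : θ ≤ Real.pi / 2) {K : ℕ}
    (hK : 1 ≤ 2 ^ K * θ) :
    ∃ k ≤ K, 1 / 2 ≤ Real.sin ((2 * ((2 ^ k - 1 : ℕ) : ℝ) + 1) * θ) ^ 2 := by
  have h0 : 0 < θ := by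
    by_contra h
    have : 2 ^ K * θ ≤ 0 := mul_nonpos_of_nonneg_of_nonpos (by positivity) (not_lt.1 h)
    linarith
  have hm : ∀ k : ℕ, (2 * ((2 ^ k - 1 : ℕ) : ℝ) + 1) = 2 * 2 ^ k - 1 := by
    intro k
    rw [Nat.cast_sub Nat.one_le_two_pow]
    push_cast; ring
  have hone : ∀ k : ℕ, (1 : ℝ) ≤ 2 ^ k := fun k => one_le_pow₀ (by norm_num)
  have hex : ∃ k : ℕ, Real.pi / 4 ≤ (2 * 2 ^ k - 1) * θ :=
    -- Here `2 * 2 ^ K - 1 ≥ 2 ^ K`, so the angle is at least `1 > π / 4`.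
    ⟨K, by nlinarith [hone K, Real.pi_lt_four]⟩
  classical
  refine ⟨Nat.find hex, Nat.find_min' hex (by nlinarith [hone K, Real.pi_lt_four]), ?_⟩
  rw [hm]
  refine half_le_sin_sq (Nat.find_spec hex) ?_
  rcases Nat.eq_zero_or_pos (Nat.find hex) with h | h
  · rw [h]
    linarith
  · obtain ⟨k, hk⟩ : ∃ k, Nat.find hex = k + 1 := ⟨_, (Nat.succ_pred_eq_of_pos h).symm⟩
    -- The previous angle is below `π / 4`, and `4 * 2 ^ k - 1 ≤ 3 * (2 * 2 ^ k - 1)`, so the first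
    -- angle past `π / 4` is still below `3π / 4`.
    have := Nat.find_min hex (m := k) (by omega)
    rw [not_le] at this
    rw [hk, pow_succ]
    nlinarith [mul_le_mul_of_nonneg_right (hone k) h0.le]

end Amplitudes

/-! ### Grover iterations on the quantum state -/

section Grover

open Classical

variable {w : ℕ} {W : ℕ → ℕ → Option ℤ}

/-- The number of marked triples. -/
noncomputable def rank (W : ℕ → ℕ → Option ℤ) (thr : BitVec w) : ℕ :=
  (Finset.univ.filter (Marked W thr)).card

/-- The three vertices are numbers below `2 ^ n`. -/
def InBox (n : ℕ) (v : BitVec w × BitVec w × BitVec w) : Prop :=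
  v.1.toNat < 2 ^ n ∧ v.2.1.toNat < 2 ^ n ∧ v.2.2.toNat < 2 ^ n

/-- The number of triples of numbers below `2 ^ n`. -/
noncomputable def boxCard (w n : ℕ) : ℕ :=
  (Finset.univ.filter (InBox (w := w) n)).card

/-- The amplitude of the uniform superposition of all triples of `n`-bit numbers. -/
noncomputable def unifAmp (n : ℕ) : ℝ := (Real.sqrt 2)⁻¹ ^ (3 * n)

/-- The basis state with given vertices and zero scratch registers. -/
def vec (v : BitVec w × BitVec w × BitVec w) : Fin 15 → BitVec w := fun r =>
  if r = 0 then v.1 else if r = 1 then v.2.1 else if r = 2 then v.2.2 else 0#w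

theorem vec_scratch (v : BitVec w × BitVec w × BitVec w) : ScratchZero (vec v) := by
  intro r hr
  have h0 : r ≠ 0 := by rintro rfl; exact absurd hr (by decide)
  have h1 : r ≠ 1 := by rintro rfl; exact absurd hr (by decide)
  have h2 : r ≠ 2 := by rintro rfl; exact absurd hr (by decide)
  simp [vec, h0, h1, h2]

theorem lt_three (r : Fin 15) (h : ¬ 3 ≤ r) : r = 0 ∨ r = 1 ∨ r = 2 := by
  revert r; decide

theorem ScratchZero.eq_vec {x : Fin 15 → BitVec w} (h : ScratchZero x) :
    x = vec (x 0, x 1, x 2) := by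
  funext r
  by_cases hr : 3 ≤ r
  · rw [h r hr, vec_scratch _ r hr]
  · rcases lt_three r hr with rfl | rfl | rfl <;> simp [vec]

theorem vec_injective : Function.Injective (vec (w := w)) := by
  intro v v' h
  have h0 := congrFun h 0
  have h1 := congrFun h 1
  have h2 := congrFun h 2
  simp [vec] at h0 h1 h2
  exact Prod.ext h0 (Prod.ext h1 h2)

theorem sum_eq_sum_vec {R : Type*} [AddCommMonoid R] {g : (Fin 15 → BitVec w) → R}
    (h : ∀ x, ¬ ScratchZero x → g x = 0) : ∑ x, g x = ∑ v, g (vec v) := by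
  refine (Fintype.sum_of_injective vec vec_injective _ _ (fun x hx => h x fun hs => ?_)
    fun _ => rfl).symm
  exact hx ⟨_, hs.eq_vec.symm⟩

theorem Box.scratchZero {n : ℕ} {x : Fin 15 → BitVec w} (h : Box (vertexBox n) x) :
    ScratchZero x := by
  intro r hr
  have := h r
  rw [vertexBox, if_neg (not_lt.2 hr), pow_zero, Nat.lt_one_iff] at this
  exact BitVec.eq_of_toNat_eq this

theorem box_vec_iff (n : ℕ) (v : BitVec w × BitVec w × BitVec w) :
    Box (vertexBox n) (vec v) ↔ InBox n v := by
  constructor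
  · intro h
    have h0 := h 0
    have h1 := h 1
    have h2 := h 2
    simp [vec, vertexBox] at h0 h1 h2
    exact ⟨h0, h1, h2⟩
  · rintro ⟨h0, h1, h2⟩ r
    by_cases hr : 3 ≤ r
    · simp [vec_scratch v r hr]
    · rcases lt_three r hr with rfl | rfl | rfl <;> simpa [vec, vertexBox]

/-- The state with amplitude `a` at marked triples, and `b` at the others. -/
noncomputable def twoLevel (W : ℕ → ℕ → Option ℤ) (n : ℕ) (thr : BitVec w) (a b : ℝ) :
    QState w 15 := fun x =>
  if Box (vertexBox n) x then (if Marked W thr (x 0, x 1, x 2) then (a : ℂ) else b) else 0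

theorem twoLevel_vec (n : ℕ) (thr : BitVec w) (a b : ℝ) (v : BitVec w × BitVec w × BitVec w) :
    twoLevel W n thr a b (vec v) =
      if InBox n v then (if Marked W thr v then (a : ℂ) else b) else 0 := by
  simp [twoLevel, box_vec_iff, vec]

theorem twoLevel_supported (n : ℕ) (thr : BitVec w) (a b : ℝ) :
    Supported (twoLevel W n thr a b) := by
  intro x hx
  rw [twoLevel, if_neg fun h => hx h.scratchZero]

theorem uniform_eq_twoLevel (n : ℕ) (thr : BitVec w) :
    uniform (vertexBox n) = twoLevel W n thr (unifAmp n) (unifAmp n) := by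
  have hs : ∑ r, vertexBox n r = 3 * n := by
    simp [vertexBox, Fin.sum_univ_succ]
    ring
  funext x
  simp [uniform, twoLevel, unifAmp, hs]

theorem sum_ite_inBox {R : Type*} [CommRing R] {n : ℕ} {thr : BitVec w}
    (hM : ∀ v, Marked W thr v → InBox n v) (A B : R) :
    ∑ v, (if InBox n v then (if Marked W thr v then A else B) else 0) =
      rank W thr * A + (boxCard w n - rank W thr) * B := by
  have h : ∀ v, (if InBox n v then (if Marked W thr v then A else B) else 0) =
      (if Marked W thr v then A - B else 0) + (if InBox n v then B else 0) := by
    intro v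
    by_cases h1 : Marked W thr v
    · simp [h1, hM v h1]
    · simp [h1]
  simp only [h, Finset.sum_add_distrib, ← Finset.sum_filter, Finset.sum_const, nsmul_eq_mul, rank,
    boxCard]
  ring

/-- The number of triples is never counted directly: the uniform state is a Hadamard transform of a
unit vector, so its squared norm is one. -/
theorem boxCard_mul_unifAmp {n : ℕ} (hn : n ≤ w) : (boxCard w n : ℝ) * unifAmp n ^ 2 = 1 := by
  have h := sum_uniform_mul_self hn
  -- The choice of oracle and threshold is irrelevant, because both levels have the same amplitude.
  rw [uniform_eq_twoLevel (W := fun _ _ => none) n 0#w, sum_eq_sum_vec] at h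
  · simp only [twoLevel_vec, ite_self, ite_mul, zero_mul, mul_ite, mul_zero] at h
    simp only [← Finset.sum_filter, Finset.sum_const, nsmul_eq_mul, Finset.filter_filter,
      and_self] at h
    rw [boxCard]
    norm_cast at h
    rw [pow_two]
    exact_mod_cast h
  · intro x hx
    rw [twoLevel_supported _ _ _ _ x hx, zero_mul]

theorem sum_uniform_mul_twoLevel {n : ℕ} {thr : BitVec w}
    (hM : ∀ v, Marked W thr v → InBox n v) (a b : ℝ) :
    ∑ x, uniform (vertexBox n) x * twoLevel W n thr a b x =
      ((unifAmp n * (rank W thr * a + (boxCard w n - rank W thr) * b) : ℝ) : ℂ) := by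
  have h : ∀ x, uniform (vertexBox n) x * twoLevel W n thr a b x =
      twoLevel W n thr (unifAmp n * a) (unifAmp n * b) x := by
    intro x
    rw [uniform_eq_twoLevel (W := W) n thr]
    simp only [twoLevel]
    split_ifs <;> simp
  simp only [h]
  rw [sum_eq_sum_vec (twoLevel_supported _ _ _ _)]
  simp only [twoLevel_vec]
  rw [sum_ite_inBox hM]
  push_cast
  ring

theorem twoLevel_add (n : ℕ) (thr : BitVec w) (a b c u : ℝ) :
    twoLevel W n thr a b + (c : ℂ) • twoLevel W n thr u u =
      twoLevel W n thr (a + c * u) (b + c * u) := by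
  funext x
  simp only [twoLevel, Pi.add_apply, Pi.smul_apply, smul_eq_mul]
  split_ifs <;> simp

/-- The oracle negates the marked level, and reflection in the uniform state again yields a
two-level state. The scalar `α` carries the amplitude of the branch from earlier measurements. -/
theorem run_groverStep {cl : Fin 16 → BitVec w} {n : ℕ} (hw : 0 < w) (hn : n < 2 ^ w)
    (hnw : n ≤ w) (h7 : cl 7 = BitVec.ofNat w n) (h5 : cl 5 = BitVec.ofNat w n)
    (hM : ∀ v, Marked W (cl 4) v → InBox n v) (α : ℂ) (a b : ℝ) (t : ℕ) :
    run W groverStep ⟨cl, α • twoLevel W n (cl 4) a b, t⟩ =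
      {⟨cl, α • twoLevel W n (cl 4)
        (-a - 2 * unifAmp n ^ 2 * (rank W (cl 4) * -a + (boxCard w n - rank W (cl 4)) * b))
        (b - 2 * unifAmp n ^ 2 * (rank W (cl 4) * -a + (boxCard w n - rank W (cl 4)) * b)),
        t + (34 + 10 * n)⟩} := by
  obtain ⟨f, hf, hf'⟩ := isPhase_phaseOracle (W := W) hw cl
  obtain ⟨g, hg, hg'⟩ := isPhase_phaseZero (W := W) hw (Function.update cl 7 0#w)
  have h1 : (fun x => f x * (α • twoLevel W n (cl 4) a b) x) = α • twoLevel W n (cl 4) (-a) b := by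
    funext x
    by_cases hx : ScratchZero x
    · simp only [hf' x hx, twoLevel, Pi.smul_apply, smul_eq_mul]
      split_ifs <;> simp
    · simp [twoLevel_supported _ _ _ _ x hx]
  rw [groverStep, run_seq_of_run_eq (hf _ _), h1, run_seq_of_run_eq (run_hadamardsRev hn h7 h5 _ _),
    run_seq_of_run_eq (hg _ _), run_hadamards hn (by simp) (by simpa using h5)]
  have hs : Supported (α • twoLevel W n (cl 4) (-a) b) := fun x hx => by
    simp [twoLevel_supported _ _ _ _ x hx]
  rw [had_mul_hadRev hnw hs hg']
  have h2 : ∑ x, uniform (vertexBox n) x * (α • twoLevel W n (cl 4) (-a) b) x =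
      α * ∑ x, uniform (vertexBox n) x * twoLevel W n (cl 4) (-a) b x := by
    rw [Finset.mul_sum]
    refine Finset.sum_congr rfl fun x _ => ?_
    simp only [Pi.smul_apply, smul_eq_mul]
    ring
  rw [h2, sum_uniform_mul_twoLevel hM, uniform_eq_twoLevel (W := W) n (cl 4)]
  congr 2
  · simp [← h7]
  · have := twoLevel_add (W := W) n (cl 4) (-a) b (-2 * (unifAmp n *
      (rank W (cl 4) * -a + (boxCard w n - rank W (cl 4)) * b))) (unifAmp n)
    rw [show ∀ z : ℝ, -2 * (α * (z : ℂ)) = α * ((-2 * z : ℝ) : ℂ) by intro z; push_cast; ring,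
      mul_smul, ← smul_add, this]
    congr 2 <;> ring
  · ring

theorem run_groverLoop {cl : Fin 16 → BitVec w} {n J : ℕ} (hw : 0 < w) (hn : n < 2 ^ w)
    (hnw : n ≤ w) (h7 : cl 7 = BitVec.ofNat w n) (h5 : cl 5 = BitVec.ofNat w n)
    (h8 : cl 8 = BitVec.ofNat w J) (hJ : J < 2 ^ w)
    (hM : ∀ v, Marked W (cl 4) v → InBox n v) (α : ℂ) (t : ℕ) :
    run W (.loop (.reg 8) groverStep) ⟨cl, α • uniform (vertexBox n), t⟩ =
      {⟨cl, α • twoLevel W n (cl 4)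
        (groverAmp (boxCard w n) (rank W (cl 4)) (unifAmp n) J).1
        (groverAmp (boxCard w n) (rank W (cl 4)) (unifAmp n) J).2,
        t + 1 + J * (35 + 10 * n)⟩} := by
  have h8' : (Operand.eval cl (.reg 8)).toNat = J := by
    simp [Operand.eval, h8, Nat.mod_eq_of_lt hJ]
  rw [run_loop, h8']
  have := iterRun_of_run_eq (W := W) (P := groverStep) J
    (fun j => (⟨cl, α • twoLevel W n (cl 4)
        (groverAmp (boxCard w n) (rank W (cl 4)) (unifAmp n) j).1
        (groverAmp (boxCard w n) (rank W (cl 4)) (unifAmp n) j).2,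
        t + 1 + j * (35 + 10 * n)⟩ : Branch w 16 15)) (by
      intro j _
      simp only [Branch.tick]
      rw [run_groverStep hw hn hnw h7 h5 hM]
      simp only [groverAmp]
      congr 2
      ring)
  rw [← this]
  simp [groverAmp, Branch.tick, uniform_eq_twoLevel (W := W) n (cl 4)]

end Grover

/-! ### Measurement, reset and classical verification -/

section Attempt

open Classical

variable {w : ℕ} {W : ℕ → ℕ → Option ℤ}

/-- The registers after a classical check of the vertices `v`. -/
structure Checked (W : ℕ → ℕ → Option ℤ) (cl : Fin 16 → BitVec w)
    (v : BitVec w × BitVec w × BitVec w) (cl' : Fin 16 → BitVec w) : Prop where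
  r5 : cl' 5 = cl 5
  r6 : cl' 6 = cl 6
  r7 : cl' 7 = 0#w
  r8 : cl' 8 = cl 8
  marked : Marked W (cl 4) v → cl' 0 = 1#w ∧ (cl' 1, cl' 2, cl' 3) = v ∧ cl' 4 = weightWord W v
  unmarked : ¬ Marked W (cl 4) v →
    cl' 0 = cl 0 ∧ cl' 1 = cl 1 ∧ cl' 2 = cl 2 ∧ cl' 3 = cl 3 ∧ cl' 4 = cl 4

theorem flag_ne_zero (hw : 0 < w) (p : Prop) : flag w p ≠ 0#w ↔ p := by
  by_cases hp : p <;> simp [flag, hp, hw.ne']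

theorem eval_reg {ι : Type} (v : ι → BitVec w) (i : ι) : Operand.eval v (.reg i) = v i := rfl

theorem eval_lit {ι : Type} (v : ι → BitVec w) (n : ℕ) :
    Operand.eval v (.lit n) = BitVec.ofNat w n := rfl

theorem run_classicalCheck (hw : 0 < w) (cl : Fin 16 → BitVec w) (psi : QState w 15) (t : ℕ)
    (h7 : cl 7 = 0#w) :
    ∃ cl', run W classicalCheck ⟨cl, psi, t⟩ = {⟨cl', psi, t + 18⟩} ∧
      Checked W cl (cl 9, cl 10, cl 11) cl' := by
  simp only [classicalCheck, run, Branch.tick, Multiset.singleton_bind, eval_reg, eval_lit,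
    eval_edge, eval_slt, eval_and, eval_add, Function.update_self, ne_eq, Fin.reduceEq,
    not_false_eq_true, Function.update_of_ne, flag_and_flag, BitVec.add_zero]
  by_cases h : Marked W (cl 4) (cl 9, cl 10, cl 11)
  · rw [if_pos]
    · refine ⟨_, rfl, ⟨?_, ?_, ?_, ?_, fun _ => ?_, fun h' => absurd h h'⟩⟩ <;>
        simp [weightWord, h7]
    · rw [← ne_eq, flag_ne_zero hw]
      simpa only [Marked, Tri, weightWord, and_assoc] using h
  · rw [if_neg]
    · refine ⟨_, rfl, ⟨?_, ?_, ?_, ?_, fun h' => absurd h' h, fun _ => ?_⟩⟩ <;> simp [h7]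
    · rw [← ne_eq, flag_ne_zero hw]
      simpa only [Marked, Tri, weightWord, and_assoc] using h

theorem map_univ_triple {α β γ δ : Type*} [Fintype α] [Fintype β] [Fintype γ]
    (f : α × β × γ → δ) :
    (Finset.univ : Finset (α × β × γ)).val.map f =
      (Finset.univ : Finset α).val.bind fun a => (Finset.univ : Finset β).val.bind fun b =>
        (Finset.univ : Finset γ).val.map fun c => f (a, b, c) := by
  rw [← Finset.univ_product_univ, ← Finset.univ_product_univ, Finset.product_val,
    Finset.product_val]
  change Multiset.map f (Multiset.bind _ fun a => Multiset.map (Prod.mk a)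
    (Multiset.bind _ fun b => Multiset.map (Prod.mk b) _)) = _
  simp [Multiset.map_bind]

/-- The classical registers after measuring the vertices `v`. -/
def measuredCl (cl : Fin 16 → BitVec w) (v : BitVec w × BitVec w × BitVec w) :
    Fin 16 → BitVec w :=
  Function.update (Function.update (Function.update cl 9 v.1) 10 v.2.1) 11 v.2.2

theorem run_measureVertices (cl : Fin 16 → BitVec w) (psi : QState w 15) (t : ℕ) :
    run W measureVertices ⟨cl, psi, t⟩ =
      (Finset.univ : Finset (BitVec w × BitVec w × BitVec w)).val.map fun v =>
        ⟨measuredCl cl v, project 2 v.2.2 (project 1 v.2.1 (project 0 v.1 psi)), t + 3⟩ := by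
  rw [map_univ_triple]
  simp only [measureVertices, run, Multiset.bind_map]
  rfl

/-- After measurement a single basis state remains, and XOR with the recorded outcome maps it to
zero. The branch is thus ready for the next attempt, and its only memory is the scalar amplitude. -/
theorem run_clearRegisters (cl : Fin 16 → BitVec w) {psi : QState w 15} (hpsi : Supported psi)
    (v : BitVec w × BitVec w × BitVec w) (t : ℕ) :
    run W clearRegisters
        ⟨measuredCl cl v, project 2 v.2.2 (project 1 v.2.1 (project 0 v.1 psi)), t⟩ =
      {⟨Function.update (measuredCl cl v) 7 0#w, psi (vec v) • zeroState, t + 4⟩} := by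
  simp only [clearRegisters, run, Branch.tick, Multiset.singleton_bind, eval_reg, eval_lit,
    eval_add, BitVec.add_zero, Sum.elim_inr, measuredCl, Function.update_self, ne_eq, Fin.reduceEq,
    not_false_eq_true, Function.update_of_ne]
  congr 2
  funext x
  simp only [applyXor, project, Function.update_self, ne_eq, Fin.reduceEq,
    not_false_eq_true, Function.update_of_ne, Pi.smul_apply, smul_eq_mul, zeroState]
  by_cases hx : ScratchZero x
  · by_cases h0 : x = 0
    · subst h0
      have : Function.update (Function.update (Function.update (0 : Fin 15 → BitVec w) 2 v.2.2) 1
          v.2.1) 0 v.1 = vec v := by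
        funext r
        by_cases hr : 3 ≤ r
        · have h0 : r ≠ 0 := by rintro rfl; exact absurd hr (by decide)
          have h1 : r ≠ 1 := by rintro rfl; exact absurd hr (by decide)
          have h2 : r ≠ 2 := by rintro rfl; exact absurd hr (by decide)
          simp [h0, h1, h2, vec]
        · rcases lt_three r hr with rfl | rfl | rfl <;> simp [vec]
      simp [this]
    · have hne : ¬ (x 0 = 0#w ∧ x 1 = 0#w ∧ x 2 = 0#w) := by
        rintro ⟨h1, h2, h3⟩
        apply h0
        funext r
        by_cases hr : 3 ≤ r
        · exact hx r hr
        · rcases lt_three r hr with rfl | rfl | rfl <;> assumption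
      have hz : ∀ a b : BitVec w, a ^^^ b = b ↔ a = 0#w := fun a b => by
        constructor
        · intro h
          simpa using congrArg (· ^^^ b) h
        · rintro rfl; simp
      simp only [hz, h0, if_false, mul_zero]
      split_ifs with h2 h1 h0
      · exact absurd ⟨h0, h1, h2⟩ hne
      all_goals rfl
  · have h0 : x ≠ 0 := by rintro rfl; exact hx fun _ _ => rfl
    rw [if_neg h0, mul_zero]
    split_ifs
    · refine hpsi _ fun h => hx fun r hr => ?_
      have h0 : r ≠ 0 := by rintro rfl; exact absurd hr (by decide)
      have h1 : r ≠ 1 := by rintro rfl; exact absurd hr (by decide)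
      have h2 : r ≠ 2 := by rintro rfl; exact absurd hr (by decide)
      simpa [h0, h1, h2] using h r hr
    all_goals rfl

theorem run_seq_of_run_eq_map {ι : Type*} {P Q : Prog 16 15} {s : Branch w 16 15}
    {S : Multiset ι} {f g : ι → Branch w 16 15} (h : run W P s = S.map f)
    (h' : ∀ i, run W Q (f i) = {g i}) : run W (.seq P Q) s = S.map g := by
  rw [run, h, Multiset.bind_map]
  simp only [h']
  exact Multiset.bind_singleton S g

/-- The amplitude of the outcome `v` after `J` Grover iterations. -/
noncomputable def outcomeAmp (W : ℕ → ℕ → Option ℤ) (n J : ℕ) (thr : BitVec w)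
    (v : BitVec w × BitVec w × BitVec w) : ℝ :=
  if InBox n v then
    (if Marked W thr v then (groverAmp (boxCard w n) (rank W thr) (unifAmp n) J).1
      else (groverAmp (boxCard w n) (rank W thr) (unifAmp n) J).2)
  else 0

theorem run_attempt {cl : Fin 16 → BitVec w} {n J : ℕ} (hw : 0 < w) (hn : n < 2 ^ w)
    (hnw : n ≤ w) (h7 : cl 7 = 0#w) (h5 : cl 5 = BitVec.ofNat w n)
    (h8 : cl 8 = BitVec.ofNat w J) (hJ : J < 2 ^ w)
    (hM : ∀ v, Marked W (cl 4) v → InBox n v) (α : ℂ) (t : ℕ) :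
    ∃ post : BitVec w × BitVec w × BitVec w → Fin 16 → BitVec w,
      (∀ v, Checked W cl v (post v)) ∧
      run W attempt ⟨cl, α • zeroState, t⟩ =
        (Finset.univ : Finset (BitVec w × BitVec w × BitVec w)).val.map fun v =>
          ⟨post v, (α * outcomeAmp W n J (cl 4) v) • zeroState,
            t + (27 + 5 * n + J * (35 + 10 * n))⟩ := by
  choose post hpost hchk using fun v => run_classicalCheck (W := W) hw
    (Function.update (measuredCl (Function.update cl 7 (BitVec.ofNat w n)) v) 7 0#w)
    ((α * outcomeAmp W n J (cl 4) v) • zeroState)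
    (t + 1 + 5 * n + 1 + J * (35 + 10 * n) + 3 + 4) (by simp)
  refine ⟨post, fun v => ?_, ?_⟩
  · obtain ⟨r5, r6, r7, r8, hm, hu⟩ := hchk v
    simp [measuredCl] at r5 r6 r7 r8 hm hu
    exact ⟨r5, r6, r7, r8, by simpa using hm, hu⟩
  · rw [attempt, run_seq_of_run_eq (run_hadamards hn h7 h5 _ _), had_smul, had_zeroState hnw]
    have hl := run_groverLoop (W := W) (cl := Function.update cl 7 (BitVec.ofNat w n)) hw hn hnw
      (by simp) (by simpa using h5) (by simpa using h8) hJ (by simpa using hM) α (t + 1 + 5 * n)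
    rw [run_seq_of_run_eq hl]
    refine run_seq_of_run_eq_map (run_measureVertices _ _ _) fun v => ?_
    have hs : Supported (α • twoLevel W n (cl 4)
        (groverAmp (boxCard w n) (rank W (cl 4)) (unifAmp n) J).1
        (groverAmp (boxCard w n) (rank W (cl 4)) (unifAmp n) J).2) := fun x hx => by
      simp [twoLevel_supported _ _ _ _ x hx]
    have h4 : Function.update cl 7 (BitVec.ofNat w n) 4 = cl 4 := by simp
    rw [h4, run_seq_of_run_eq (run_clearRegisters _ hs v _)]
    have ha : (α • twoLevel W n (cl 4)
        (groverAmp (boxCard w n) (rank W (cl 4)) (unifAmp n) J).1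
        (groverAmp (boxCard w n) (rank W (cl 4)) (unifAmp n) J).2) (vec v) =
        α * outcomeAmp W n J (cl 4) v := by
      simp only [Pi.smul_apply, smul_eq_mul, twoLevel_vec, outcomeAmp]
      split_ifs <;> simp
    rw [ha, hpost]
    congr 2
    ring

end Attempt

/-! ### Expected decrease of the rank in one attempt -/

section Rank

open Classical

variable {w : ℕ} {W : ℕ → ℕ → Option ℤ}

/-- The comparison with the threshold is strict, so `v` itself ceases to be marked. -/
theorem rank_weightWord_lt {thr : BitVec w} {v : BitVec w × BitVec w × BitVec w}
    (h : Marked W thr v) : rank W (weightWord W v) < rank W thr := by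
  refine Finset.card_lt_card (Finset.ssubset_iff_of_subset ?_ |>.2 ⟨v, by simpa using h, ?_⟩)
  · intro u hu
    simp only [Finset.mem_filter, Finset.mem_univ, true_and] at hu ⊢
    exact ⟨hu.1, hu.2.trans h.2⟩
  · simp [Marked]

/-- A random marked triple has at most half of the marked triples below it. -/
theorem two_mul_sum_rank_le (thr : BitVec w) :
    2 * ∑ v ∈ Finset.univ.filter (Marked W thr), rank W (weightWord W v) ≤ rank W thr ^ 2 := by
  set Mk := Finset.univ.filter (Marked W thr) with hMk
  have h1 : ∀ v ∈ Mk, rank W (weightWord W v) =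
      ∑ u ∈ Mk, if (weightWord W u).toInt < (weightWord W v).toInt then 1 else 0 := by
    intro v hv
    rw [← Finset.sum_filter, Finset.sum_const, smul_eq_mul, mul_one, rank]
    congr 1
    ext u
    simp only [hMk, Finset.mem_filter, Finset.mem_univ, true_and] at hv ⊢
    exact ⟨fun h => ⟨⟨h.1, h.2.trans hv.2⟩, h.2⟩, fun h => ⟨h.1.1, h.2⟩⟩
  -- Count ordered pairs of marked triples twice, once with the roles exchanged: at most one of the
  -- two strict weight comparisons holds for each pair.
  rw [Finset.sum_congr rfl h1, two_mul]
  nth_rewrite 2 [Finset.sum_comm]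
  rw [← Finset.sum_add_distrib]
  simp only [← Finset.sum_add_distrib]
  calc _ ≤ ∑ v ∈ Mk, ∑ u ∈ Mk, 1 := by
        refine Finset.sum_le_sum fun v _ => Finset.sum_le_sum fun u _ => ?_
        split_ifs <;> omega
    _ = rank W thr ^ 2 := by simp [rank, hMk, pow_two]

/-- The rotation angle of Grover's algorithm. -/
noncomputable def angle (W : ℕ → ℕ → Option ℤ) (n : ℕ) (thr : BitVec w) : ℝ :=
  Real.arcsin (Real.sqrt (rank W thr * unifAmp n ^ 2))

/-- The probability that a marked triple is measured after `J` Grover iterations. -/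
noncomputable def success (W : ℕ → ℕ → Option ℤ) (n J : ℕ) (thr : BitVec w) : ℝ :=
  Real.sin ((2 * J + 1) * angle W n thr) ^ 2

theorem sin_angle {n : ℕ} (hn : n ≤ w) {thr : BitVec w}
    (hM : ∀ v, Marked W thr v → InBox n v) :
    Real.sin (angle W n thr) = Real.sqrt (rank W thr * unifAmp n ^ 2) := by
  have h0 : 0 ≤ Real.sqrt (rank W thr * unifAmp n ^ 2) := Real.sqrt_nonneg _
  refine Real.sin_arcsin (by linarith) (Real.sqrt_le_one.2 ?_)
  rw [← boxCard_mul_unifAmp hn]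
  refine mul_le_mul_of_nonneg_right ?_ (by positivity)
  exact_mod_cast Finset.card_le_card fun v hv => by simpa using hM v (by simpa using hv)

theorem sin_angle_sq {n : ℕ} (hn : n ≤ w) {thr : BitVec w}
    (hM : ∀ v, Marked W thr v → InBox n v) :
    Real.sin (angle W n thr) ^ 2 = rank W thr * unifAmp n ^ 2 := by
  rw [sin_angle hn hM, Real.sq_sqrt (by positivity)]

theorem sum_outcomeAmp_mul {n J : ℕ} (hn : n ≤ w) {thr : BitVec w}
    (hM : ∀ v, Marked W thr v → InBox n v) (g : BitVec w × BitVec w × BitVec w → ℝ) (K : ℝ) :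
    ∑ v, outcomeAmp W n J thr v ^ 2 * (if Marked W thr v then g v else K) =
      (groverAmp (boxCard w n) (rank W thr) (unifAmp n) J).1 ^ 2 *
        ∑ v ∈ Finset.univ.filter (Marked W thr), g v + (1 - success W n J thr) * K := by
  have hamp := mul_groverAmp_sq (boxCard_mul_unifAmp hn) (sin_angle_sq hn hM) J
  set a := (groverAmp (boxCard w n) (rank W thr) (unifAmp n) J).1
  set b := (groverAmp (boxCard w n) (rank W thr) (unifAmp n) J).2
  have h : ∀ v, outcomeAmp W n J thr v ^ 2 * (if Marked W thr v then g v else K) =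
      (if Marked W thr v then a ^ 2 * g v else 0) +
        (if InBox n v then (if Marked W thr v then 0 else b ^ 2 * K) else 0) := by
    intro v
    by_cases h1 : Marked W thr v
    · simp [h1, outcomeAmp, hM v h1, a]
    · by_cases h2 : InBox n v <;> simp [h1, h2, outcomeAmp, b]
  simp only [h, Finset.sum_add_distrib]
  rw [sum_ite_inBox hM, ← Finset.sum_filter, ← Finset.mul_sum, success, ← Real.cos_sq', ← hamp.2]
  ring

theorem sum_outcomeAmp_sq {n J : ℕ} (hn : n ≤ w) {thr : BitVec w}
    (hM : ∀ v, Marked W thr v → InBox n v) : ∑ v, outcomeAmp W n J thr v ^ 2 = 1 := by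
  have h := sum_outcomeAmp_mul (J := J) hn hM (fun _ => 1) 1
  have hamp := mul_groverAmp_sq (boxCard_mul_unifAmp hn) (sin_angle_sq hn hM) J
  simp only [ite_self, mul_one, Finset.sum_const, nsmul_eq_mul] at h
  rw [h, success, ← hamp.1, rank]
  ring

/-- All marked triples have the same amplitude, so a marked outcome is uniform and the halving bound
applies. The free value `K` stands for what the unmarked outcomes contribute. -/
theorem sum_outcomeAmp_mul_rank_le {n J : ℕ} (hn : n ≤ w) {thr : BitVec w}
    (hM : ∀ v, Marked W thr v → InBox n v) (K : ℝ) :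
    ∑ v, outcomeAmp W n J thr v ^ 2 *
        (if Marked W thr v then (rank W (weightWord W v) : ℝ) else K) ≤
      success W n J thr * rank W thr / 2 + (1 - success W n J thr) * K := by
  have hamp := mul_groverAmp_sq (boxCard_mul_unifAmp hn) (sin_angle_sq hn hM) J
  have h : (2 : ℝ) * ∑ v ∈ Finset.univ.filter (Marked W thr), (rank W (weightWord W v) : ℝ) ≤
      (rank W thr : ℝ) ^ 2 := by exact_mod_cast two_mul_sum_rank_le (W := W) thr
  rw [sum_outcomeAmp_mul hn hM, success, ← hamp.1]
  nlinarith [sq_nonneg (groverAmp (boxCard w n) (rank W thr) (unifAmp n) J).1]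

theorem two_pow_mul_unifAmp (h : ℕ) : 2 ^ (3 * h) * unifAmp (2 * h) = 1 := by
  have h6 : (Real.sqrt 2)⁻¹ ^ 6 = 1 / 8 := by
    have : Real.sqrt 2 ^ 6 = (Real.sqrt 2 ^ 2) ^ 3 := by rw [← pow_mul]
    rw [inv_pow, this, Real.sq_sqrt (by norm_num)]
    norm_num
  rw [unifAmp, show 3 * (2 * h) = 6 * h by ring, pow_mul, pow_mul, h6, ← mul_pow]
  norm_num

/-- One marked triple already forces `θ ≥ sin θ ≥ unifAmp (2 * h) = 2 ^ (-3h)`, which is why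
exponents up to `3 * h` suffice. -/
theorem exists_half_le_success {h : ℕ} (hn : 2 * h ≤ w) {thr : BitVec w}
    (hM : ∀ v, Marked W thr v → InBox (2 * h) v) (hr : 0 < rank W thr) :
    ∃ k ≤ 3 * h, 1 / 2 ≤ success W (2 * h) (2 ^ k - 1) thr := by
  refine exists_half_le_sin_sq (Real.arcsin_le_pi_div_two _) ?_
  rw [← two_pow_mul_unifAmp h]
  refine mul_le_mul_of_nonneg_left ?_ (by positivity)
  have h0 : 0 ≤ angle W (2 * h) thr := Real.arcsin_nonneg.2 (Real.sqrt_nonneg _)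
  refine le_trans ?_ ((sin_angle hn hM).symm.le.trans (Real.sin_le h0))
  refine Real.le_sqrt_of_sq_le ?_
  have : (1 : ℝ) ≤ rank W thr := by exact_mod_cast hr
  nlinarith [sq_nonneg (unifAmp (2 * h))]

end Rank

/-! ### Contraction of the expected rank by a sweep -/

section Sweep

open Classical

variable {w : ℕ} {W : ℕ → ℕ → Option ℤ}

/-- The state between two attempts: the quantum registers are zero, and the outputs are a triangle
whose weight is the threshold, or nothing has been found and the threshold is `thr₀`. -/
structure Ready (W : ℕ → ℕ → Option ℤ) (h : ℕ) (thr₀ : BitVec w) (s : Branch w 16 15) : Prop where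
  r5 : s.cl 5 = BitVec.ofNat w (2 * h)
  r6 : s.cl 6 = BitVec.ofNat w (3 * h + 1)
  r7 : s.cl 7 = 0#w
  out : (s.cl 0 = 0#w ∧ s.cl 4 = thr₀) ∨
    (s.cl 0 ≠ 0#w ∧ Tri W (s.cl 1, s.cl 2, s.cl 3) ∧
      s.cl 4 = weightWord W (s.cl 1, s.cl 2, s.cl 3))
  psi : ∃ α : ℂ, s.psi = α • zeroState

/-- The number of triangles lighter than the current threshold. -/
noncomputable def Branch.rank (W : ℕ → ℕ → Option ℤ) (s : Branch w 16 15) : ℕ :=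
  QMachine.rank W (s.cl 4)

theorem Ready.tick {h : ℕ} {thr₀ : BitVec w} {s : Branch w 16 15} (hs : Ready W h thr₀ s) :
    Ready W h thr₀ s.tick :=
  ⟨hs.r5, hs.r6, hs.r7, hs.out, hs.psi⟩

theorem prob_smul_zeroState (cl : Fin 16 → BitVec w) (α : ℂ) (t : ℕ) :
    Branch.prob (⟨cl, α • zeroState, t⟩ : Branch w 16 15) = ‖α‖ ^ 2 := by
  rw [Branch.prob, Finset.sum_eq_single 0]
  · simp [zeroState]
  · intro x _ hx; simp [zeroState, hx]
  · simp

theorem Branch.prob_nonneg {c q : ℕ} (s : Branch w c q) : 0 ≤ s.prob :=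
  Finset.sum_nonneg fun _ _ => by positivity

theorem total_map_univ {c q : ℕ} {ι : Type*} [Fintype ι] (f : ι → Branch w c q)
    (Φ : Branch w c q → ℝ) :
    total ((Finset.univ : Finset ι).val.map f) Φ = ∑ i, Φ (f i) := by
  rw [total, Multiset.map_map]
  rfl

/-- The number of steps of an attempt with `2 ^ k - 1` iterations. -/
def bodyTime (h k : ℕ) : ℕ := 29 + 10 * h + (2 ^ k - 1) * (35 + 20 * h)

/-- The free factor `c` prepares the induction over a sweep: it is the contraction still guaranteed
by the remaining attempts on branches where the rank has not moved. -/
theorem run_sweepBody {h k : ℕ} {thr₀ : BitVec w} {s : Branch w 16 15} (hw : 3 * h + 2 ≤ w)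
    (hT : ∀ v : BitVec w × BitVec w × BitVec w, Tri W v → InBox (2 * h) v)
    (hs : Ready W h thr₀ s) (hk : k ≤ 3 * h) (h8 : s.cl 8 = BitVec.ofNat w (2 ^ k - 1)) :
    (∀ s' ∈ run W sweepBody s, Ready W h thr₀ s' ∧ s'.cl 8 = BitVec.ofNat w (2 ^ (k + 1) - 1) ∧
      s'.rank W ≤ s.rank W ∧ s'.time = s.time + bodyTime h k) ∧
    total (run W sweepBody s) Branch.prob = s.prob ∧
    ∀ c : ℝ, total (run W sweepBody s) (fun s' => s'.prob *
        (if s'.rank W = s.rank W then c * s.rank W else s'.rank W)) ≤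
      s.prob * (success W (2 * h) (2 ^ k - 1) (s.cl 4) * s.rank W / 2 +
        (1 - success W (2 * h) (2 ^ k - 1) (s.cl 4)) * (c * s.rank W)) := by
  obtain ⟨cl, psi, t⟩ := s
  obtain ⟨h5, h6, h7, hout, α, rfl⟩ := hs
  simp only at h5 h6 h7 hout h8
  have hM : ∀ v, Marked W (cl 4) v → InBox (2 * h) v := fun v hv => hT v hv.1
  have hnw : 2 * h ≤ w := by omega
  have h2h : 2 * h < 2 ^ w := hnw.trans_lt Nat.lt_two_pow_self
  have hJ : 2 ^ k - 1 < 2 ^ w :=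
    lt_of_lt_of_le (Nat.sub_lt (Nat.two_pow_pos k) one_pos)
      (Nat.pow_le_pow_right (by norm_num) (by omega))
  obtain ⟨post, hpost, hrun⟩ := run_attempt (by omega) h2h hnw h7 h5 h8 hJ hM α t
  have hfin := run_seq_of_run_eq_map hrun (Q := .seq (.assign 8 .add (.reg 8) (.reg 8))
    (.assign 8 .add (.reg 8) (.lit 1))) (g := fun v =>
      ⟨Function.update (post v) 8 (cl 8 + cl 8 + BitVec.ofNat w 1),
        (α * outcomeAmp W (2 * h) (2 ^ k - 1) (cl 4) v) • zeroState, t + bodyTime h k⟩) (by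
      intro v
      simp only [run, Branch.tick, Multiset.singleton_bind, eval_reg, eval_lit, eval_add,
        Function.update_self, Function.update_idem, (hpost v).r8, bodyTime]
      congr 2
      ring)
  have h4 : ∀ v, Function.update (post v) 8 (cl 8 + cl 8 + BitVec.ofNat w 1) 4 =
      if Marked W (cl 4) v then weightWord W v else cl 4 := by
    intro v
    by_cases hv : Marked W (cl 4) v
    · simp [hv, ((hpost v).marked hv).2.2]
    · simp [hv, ((hpost v).unmarked hv).2.2.2.2]
  rw [sweepBody, hfin]
  refine ⟨?_, ?_, fun c => ?_⟩
  · intro s' hs'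
    obtain ⟨v, -, rfl⟩ := Multiset.mem_map.1 hs'
    have hv := hpost v
    refine ⟨⟨by simp [hv.r5, h5], by simp [hv.r6, h6], by simp [hv.r7], ?_, _, rfl⟩, ?_, ?_, rfl⟩
    · by_cases hm : Marked W (cl 4) v
      · obtain ⟨e0, e1, e4⟩ := hv.marked hm
        right
        simp only [ne_eq, Fin.reduceEq, not_false_eq_true, Function.update_of_ne, e0, e1, e4]
        exact ⟨by simp; omega, hm.1, trivial⟩
      · obtain ⟨e0, e1, e2, e3, e4⟩ := hv.unmarked hm
        simpa [e0, e1, e2, e3, e4] using hout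
    -- Doubling and adding one maps `2 ^ k - 1` to `2 ^ (k + 1) - 1`.
    · simp only [Function.update_self, h8, ← BitVec.ofNat_add]
      congr 1
      have := Nat.two_pow_pos k
      rw [pow_succ]
      omega
    · simp only [Branch.rank, h4 v]
      by_cases hm : Marked W (cl 4) v
      · rw [if_pos hm]
        exact (rank_weightWord_lt hm).le
      · rw [if_neg hm]
  · rw [total_map_univ]
    simp only [prob_smul_zeroState, norm_mul, mul_pow, ← Finset.mul_sum, Complex.norm_real,
      Real.norm_eq_abs, sq_abs, sum_outcomeAmp_sq hnw hM, mul_one]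
  · rw [total_map_univ]
    simp only [prob_smul_zeroState, norm_mul, mul_pow, Complex.norm_real,
      Real.norm_eq_abs, sq_abs, Branch.rank, h4, mul_assoc (‖α‖ ^ 2), ← Finset.mul_sum]
    refine mul_le_mul_of_nonneg_left ?_ (by positivity)
    refine le_trans (le_of_eq ?_) (sum_outcomeAmp_mul_rank_le hnw hM _)
    refine Finset.sum_congr rfl fun v _ => ?_
    congr 1
    by_cases hm : Marked W (cl 4) v
    · simp [hm, (rank_weightWord_lt hm).ne]
    · simp [hm]

/-- On ready states, the program `P` preserves readiness and total probability, contracts the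
expected rank by the factor `ρ`, and takes at most `T` steps. -/
structure Contracts (W : ℕ → ℕ → Option ℤ) (h : ℕ) (thr₀ : BitVec w) (P : Prog 16 15) (ρ : ℝ)
    (T : ℕ) : Prop where
  ready : ∀ s, Ready W h thr₀ s → ∀ s' ∈ run W P s, Ready W h thr₀ s' ∧ s'.time ≤ s.time + T
  prob : ∀ s, Ready W h thr₀ s → total (run W P s) Branch.prob = s.prob
  rank : ∀ s, Ready W h thr₀ s →
    total (run W P s) (fun s' => s'.prob * s'.rank W) ≤ ρ * (s.prob * s.rank W)

/-- The contraction holds from every ready state, so it applies branch by branch and the factors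
multiply, as for conditional expectations. -/
theorem Contracts.loop {h : ℕ} {thr₀ : BitVec w} {P : Prog 16 15} {ρ : ℝ} {T : ℕ}
    (hP : Contracts W h thr₀ P ρ T) (hρ : 0 ≤ ρ) {a : Operand (Fin 16)} {m : ℕ}
    (ha : ∀ s, Ready W h thr₀ s → (a.eval s.cl).toNat = m) :
    Contracts W h thr₀ (.loop a P) (ρ ^ m) (1 + m * (T + 1)) := by
  have key : ∀ (m : ℕ) (s : Branch w 16 15), Ready W h thr₀ s →
      (∀ s' ∈ iterRun W P m s, Ready W h thr₀ s' ∧ s'.time ≤ s.time + m * (T + 1)) ∧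
      total (iterRun W P m s) Branch.prob = s.prob ∧
      total (iterRun W P m s) (fun s' => s'.prob * s'.rank W) ≤ ρ ^ m * (s.prob * s.rank W) := by
    intro m
    induction m with
    | zero =>
      intro s hs
      simp [iterRun, total_singleton, hs]
    | succ m ih =>
      intro s hs
      have hst := hs.tick
      refine ⟨fun s' hs' => ?_, ?_, ?_⟩
      · obtain ⟨s₁, h1, h2⟩ := Multiset.mem_bind.1 hs'
        obtain ⟨r1, t1⟩ := hP.ready _ hst s₁ h1
        obtain ⟨r2, t2⟩ := (ih s₁ r1).1 s' h2
        refine ⟨r2, ?_⟩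
        have : s.tick.time = s.time + 1 := rfl
        have : (m + 1) * (T + 1) = m * (T + 1) + (T + 1) := by ring
        omega
      · rw [iterRun, total_bind, total_congr fun s₁ h1 => (ih s₁ (hP.ready _ hst s₁ h1).1).2.1,
          hP.prob _ hst]
        rfl
      · rw [iterRun, total_bind]
        refine (total_mono fun s₁ h1 => (ih s₁ (hP.ready _ hst s₁ h1).1).2.2).trans ?_
        rw [total_mul_left, pow_succ, mul_assoc]
        exact mul_le_mul_of_nonneg_left (hP.rank _ hst) (by positivity)
  constructor <;> intro s hs <;> rw [run_loop, ha s hs]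
  · intro s' hs'
    obtain ⟨h1, h2⟩ := (key m _ hs.tick).1 s' hs'
    have : s.tick.time = s.time + 1 := rfl
    exact ⟨h1, by omega⟩
  · exact (key m _ hs.tick).2.1
  · exact (key m _ hs.tick).2.2

/-- The good exponent `j` is determined by the rank at the start. If an earlier attempt succeeds,
`j` may no longer be good, but then the rank has already been halved in expectation; otherwise the
rank is unchanged and `j` is still good. -/
theorem iterRun_sweepBody {h : ℕ} {thr₀ : BitVec w} (hw : 3 * h + 2 ≤ w)
    (hT : ∀ v : BitVec w × BitVec w × BitVec w, Tri W v → InBox (2 * h) v) (m : ℕ) :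
    ∀ (k : ℕ) (s : Branch w 16 15), Ready W h thr₀ s → k + m ≤ 3 * h + 1 →
      s.cl 8 = BitVec.ofNat w (2 ^ k - 1) →
      (∀ s' ∈ iterRun W sweepBody m s, Ready W h thr₀ s' ∧ s'.rank W ≤ s.rank W ∧
        s'.time ≤ s.time + (2 ^ (k + m) - 2 ^ k) * (65 * (h + 1))) ∧
      total (iterRun W sweepBody m s) Branch.prob = s.prob ∧
      ((∃ j, k ≤ j ∧ j < k + m ∧ 1 / 2 ≤ success W (2 * h) (2 ^ j - 1) (s.cl 4)) →
        total (iterRun W sweepBody m s) (fun s' => s'.prob * s'.rank W) ≤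
          3 / 4 * (s.prob * s.rank W)) := by
  induction m with
  | zero =>
    intro k s hs _ _
    refine ⟨by simp [iterRun, hs], by simp [iterRun, total_singleton], ?_⟩
    rintro ⟨j, h1, h2, -⟩
    omega
  | succ m ih =>
    intro k s hs hk h8
    obtain ⟨hall, hprob, hrank⟩ := run_sweepBody hw hT hs.tick (k := k) (by omega) h8
    have ih' : ∀ s₁ ∈ run W sweepBody s.tick, _ := fun s₁ h1 =>
      ih (k + 1) s₁ (hall s₁ h1).1 (by omega) (hall s₁ h1).2.1
    have htick : s.tick.rank W = s.rank W := rfl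
    have hptick : s.tick.prob = s.prob := rfl
    have hctick : s.tick.cl = s.cl := rfl
    refine ⟨fun s' hs' => ?_, ?_, ?_⟩
    · obtain ⟨s₁, h1, h2⟩ := Multiset.mem_bind.1 hs'
      obtain ⟨r1, -, k1, t1⟩ := hall s₁ h1
      obtain ⟨r2, k2, t2⟩ := (ih' s₁ h1).1 s' h2
      refine ⟨r2, k2.trans k1, ?_⟩
      have e1 : s.tick.time = s.time + 1 := rfl
      -- The cost of attempt `k` is bounded by a multiple of `2 ^ k`, so that the total telescopes.
      have e2 : bodyTime h k + 1 ≤ 2 ^ k * (65 * (h + 1)) := by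
        obtain ⟨y, hy⟩ : ∃ y, 2 ^ k = y + 1 :=
          ⟨2 ^ k - 1, (Nat.sub_add_cancel Nat.one_le_two_pow).symm⟩
        rw [bodyTime, hy, Nat.add_sub_cancel]
        nlinarith [Nat.zero_le (y * h)]
      have e3 : 2 ^ (k + (m + 1)) - 2 ^ k = (2 ^ (k + 1 + m) - 2 ^ (k + 1)) + 2 ^ k := by
        have : 2 ^ (k + 1) ≤ 2 ^ (k + 1 + m) := Nat.pow_le_pow_right (by norm_num) (by omega)
        rw [show k + (m + 1) = k + 1 + m by ring]
        rw [pow_succ] at this ⊢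
        omega
      rw [e3, add_mul]
      omega
    · rw [iterRun, total_bind, total_congr fun s₁ h1 => (ih' s₁ h1).2.1, hprob]
      rfl
    · rintro ⟨j, hj1, hj2, hj⟩
      rw [iterRun, total_bind]
      have hmono : ∀ s₁ ∈ run W sweepBody s.tick,
          total (iterRun W sweepBody m s₁) (fun s' => s'.prob * s'.rank W) ≤
            s₁.prob * s₁.rank W := by
        intro s₁ h1
        calc _ ≤ total (iterRun W sweepBody m s₁) (fun s' => s₁.rank W * s'.prob) := by
              refine total_mono fun s' hs' => ?_
              rw [mul_comm]
              refine mul_le_mul_of_nonneg_right ?_ s'.prob_nonneg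
              exact_mod_cast ((ih' s₁ h1).1 s' hs').2.1
          _ = _ := by rw [total_mul_left, (ih' s₁ h1).2.1, mul_comm]
      set p := success W (2 * h) (2 ^ k - 1) (s.cl 4) with hp
      have hp1 : p ≤ 1 := by
        rw [hp, success]
        exact Real.sin_sq_le_one _
      have hp0 : 0 ≤ p := sq_nonneg _
      have hpr : 0 ≤ s.prob * s.rank W := mul_nonneg s.prob_nonneg (Nat.cast_nonneg _)
      -- If the current attempt is the good one, later attempts need only not increase the rank, so
      -- `c = 1` and `p / 2 + (1 - p) ≤ 3 / 4` by `1 / 2 ≤ p`. If it is still to come, `c = 3 / 4`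
      -- works for every `p`.
      rcases eq_or_lt_of_le hj1 with rfl | hlt
      · calc _ ≤ total (run W sweepBody s.tick) (fun s' => s'.prob *
              (if s'.rank W = s.tick.rank W then (1 : ℝ) * s.tick.rank W else s'.rank W)) := by
              refine total_mono fun s₁ h1 => (hmono s₁ h1).trans (le_of_eq ?_)
              split_ifs with he
              · rw [he, one_mul]
              · rfl
          _ ≤ _ := hrank 1
          _ ≤ _ := by
              rw [htick, hptick, hctick, ← hp]
              nlinarith
      · calc _ ≤ total (run W sweepBody s.tick) (fun s' => s'.prob *
              (if s'.rank W = s.tick.rank W then (3 / 4 : ℝ) * s.tick.rank W else s'.rank W)) := by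
              refine total_mono fun s₁ h1 => ?_
              split_ifs with he
              -- The success probability depends on the threshold only through the rank.
              · have hsucc : success W (2 * h) (2 ^ j - 1) (s₁.cl 4) =
                    success W (2 * h) (2 ^ j - 1) (s.cl 4) := by
                  have he' : QMachine.rank W (s₁.cl 4) = QMachine.rank W (s.cl 4) := he
                  rw [success, success, angle, angle, he']
                have := (ih' s₁ h1).2.2 ⟨j, hlt, by omega, by rwa [hsucc]⟩
                rw [he] at this
                linarith
              · exact hmono s₁ h1
          _ ≤ _ := hrank (3 / 4)
          _ ≤ _ := by
              rw [htick, hptick, hctick, ← hp]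
              nlinarith

theorem contracts_sweep {h : ℕ} {thr₀ : BitVec w} (hw : 3 * h + 2 ≤ w)
    (hT : ∀ v : BitVec w × BitVec w × BitVec w, Tri W v → InBox (2 * h) v) :
    Contracts W h thr₀ sweep (3 / 4) (2 + 2 ^ (3 * h + 1) * (65 * (h + 1))) := by
  have key : ∀ s, Ready W h thr₀ s → ∃ s₁, run W sweep s = iterRun W sweepBody (3 * h + 1) s₁ ∧
      Ready W h thr₀ s₁ ∧ s₁.cl 8 = BitVec.ofNat w (2 ^ 0 - 1) ∧ s₁.cl 4 = s.cl 4 ∧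
      s₁.prob = s.prob ∧ s₁.time = s.time + 2 := by
    intro s hs
    have hlt : 3 * h + 1 < 2 ^ w :=
      (show 3 * h + 1 ≤ w by omega).trans_lt Nat.lt_two_pow_self
    refine ⟨⟨Function.update s.cl 8 0#w, s.psi, s.time + 1 + 1⟩, ?_, ?_, ?_, ?_, rfl, rfl⟩
    · rw [sweep, run, run, Multiset.singleton_bind, run_loop]
      simp [eval_reg, eval_lit, eval_add, hs.r6, Nat.mod_eq_of_lt hlt, Branch.tick]
    · exact ⟨by simp [hs.r5], by simp [hs.r6], by simp [hs.r7], by simpa using hs.out, hs.psi⟩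
    · simp
    · simp
  constructor <;> intro s hs <;> obtain ⟨s₁, hrun, h1, h8, h4, hp, ht⟩ := key s hs <;>
    obtain ⟨A, B, C⟩ := iterRun_sweepBody hw hT (3 * h + 1) 0 s₁ h1 (by omega) h8 <;> rw [hrun]
  · intro s' hs'
    obtain ⟨a, -, b⟩ := A s' hs'
    refine ⟨a, b.trans ?_⟩
    rw [ht, add_assoc, zero_add]
    exact Nat.add_le_add_left (Nat.add_le_add_left
      (Nat.mul_le_mul_right _ (Nat.sub_le _ _)) _) _
  · rw [B, hp]
  · rw [← hp, show s.rank W = s₁.rank W by rw [Branch.rank, Branch.rank, h4]]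
    -- With nothing marked no exponent is good, but the rank cannot increase and stays zero.
    by_cases hr : s₁.rank W = 0
    · rw [hr]
      refine (total_mono (Ψ := fun _ => 0) fun s' hs' => ?_).trans ?_
      · have := (A s' hs').2.1
        rw [hr, Nat.le_zero] at this
        simp [this]
      · simp [total]
    · obtain ⟨k, hk, hk'⟩ := exists_half_le_success (W := W) (h := h) (by omega)
        (fun v hv => hT v hv.1) (Nat.pos_of_ne_zero hr)
      exact C ⟨k, by omega, by omega, hk'⟩

end Sweep

/-! ### Computing the number of qubits and the first threshold -/

section Setup

variable {w : ℕ} {W : ℕ → ℕ → Option ℤ}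

/-- The invariant of the loop in `setup`. -/
structure SetupInv (N M i h : ℕ) (cl : Fin 16 → BitVec w) : Prop where
  r0 : cl 0 = BitVec.ofNat w N
  r1 : cl 1 = BitVec.ofNat w M
  r5 : cl 5 = BitVec.ofNat w (2 * h)
  r6 : cl 6 = BitVec.ofNat w (3 * h + 1)
  r7 : cl 7 = 0#w
  r12 : cl 12 = BitVec.ofNat w (4 ^ h)
  lt : 4 ^ h < 4 * N
  le : N ≤ 4 ^ h ∨ i ≤ h

theorem run_setup {N M : ℕ} (hN : 1 ≤ N) (hNw : 4 * N ≤ 2 ^ w) {cl : Fin 16 → BitVec w}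
    (h0 : cl 0 = BitVec.ofNat w N) (h1 : cl 1 = BitVec.ofNat w M) (h5 : cl 5 = 0#w)
    (h7 : cl 7 = 0#w) (psi : QState w 15) (t : ℕ) :
    ∃ cl' h, run W setup ⟨cl, psi, t⟩ = {⟨cl', psi, t + (7 + 7 * N)⟩} ∧ N ≤ 4 ^ h ∧
      4 ^ h < 4 * N ∧ cl' 0 = 0#w ∧ cl' 4 = BitVec.ofNat w (3 * M + 1) ∧
      cl' 5 = BitVec.ofNat w (2 * h) ∧ cl' 6 = BitVec.ofNat w (3 * h + 1) ∧ cl' 7 = 0#w := by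
  obtain ⟨cl', hrun, h, hI⟩ := iterRun_of_invariant (W := W) (psi := psi) (T := 7)
    (P := setupBody)
    (fun i cl => ∃ h, SetupInv N M i h cl) N (by
      rintro i - cl t ⟨h, hI⟩
      have hw : 0 < w := by
        by_contra h0
        rw [Nat.eq_zero_of_not_pos h0] at hNw
        omega
      have e12 : (cl 12).toNat = 4 ^ h := by
        rw [hI.r12, BitVec.toNat_ofNat, Nat.mod_eq_of_lt (by have := hI.lt; omega)]
      have e0 : (cl 0).toNat = N := by
        rw [hI.r0, BitVec.toNat_ofNat, Nat.mod_eq_of_lt (by omega)]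
      simp only [setupBody, run, Branch.tick, Multiset.singleton_bind, eval_reg, eval_lit, eval_add,
        Function.update_self, ne_eq, Fin.reduceEq, not_false_eq_true, Function.update_of_ne]
      simp only [Op.eval, e12, e0]
      by_cases hlt : 4 ^ h < N
      · rw [if_pos (by simp [hlt, hw.ne'])]
        refine ⟨_, rfl, h + 1, ?_⟩
        constructor
        · simp [hI.r0]
        · simp [hI.r1]
        · simp only [Function.update_self, ne_eq, Fin.reduceEq, not_false_eq_true,
            Function.update_of_ne, hI.r5, ← BitVec.ofNat_add]
          congr 1
        · simp only [Function.update_self, hI.r6, ← BitVec.ofNat_add]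
          congr 1
        · simp [hI.r7]
        · simp only [Function.update_self, ne_eq, Fin.reduceEq, not_false_eq_true,
            Function.update_of_ne, hI.r12, ← BitVec.ofNat_add]
          congr 1
          ring
        · rw [pow_succ]; omega
        · have := hI.le
          omega
      · rw [if_neg (by simp [hlt])]
        refine ⟨_, rfl, h, ?_⟩
        exact ⟨by simp [hI.r0], by simp [hI.r1], by simp [hI.r5], by simp [hI.r6],
          by simp [hI.r7], by simp [hI.r12], hI.lt, Or.inl (not_lt.1 hlt)⟩)
    (cl := Function.update (Function.update cl 12 1#w) 6 1#w) (t + 3)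
    ⟨0, by simp [h0], by simp [h1], by simp [h5], by simp, by simp [h7], by simp, by omega,
      Or.inr le_rfl⟩
  have e0 : N % 2 ^ w = N := Nat.mod_eq_of_lt (by omega)
  have hloop : run W (.loop (.reg 0) setupBody)
      ⟨Function.update (Function.update cl 12 1#w) 6 1#w, psi, t + 2⟩ =
        {⟨cl', psi, t + 3 + N * 7⟩} := by
    rw [run_loop, ← hrun]
    simp [eval_reg, h0, e0, Branch.tick]
  rw [setup, run_seq_of_run_eq (t := ⟨Function.update cl 12 1#w, psi, t + 1⟩)
      (by simp [run, Branch.tick, eval_lit, eval_add]),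
    run_seq_of_run_eq (t := ⟨Function.update (Function.update cl 12 1#w) 6 1#w, psi, t + 2⟩)
      (by simp [run, Branch.tick, eval_lit, eval_add]), run_seq_of_run_eq hloop]
  simp only [run, Branch.tick, Multiset.singleton_bind, eval_reg, eval_lit, eval_add,
    Function.update_self, ne_eq, Fin.reduceEq, not_false_eq_true, Function.update_of_ne,
    BitVec.add_zero]
  rw [show t + 3 + N * 7 + 1 + 1 + 1 + 1 = t + (7 + 7 * N) by ring]
  refine ⟨_, h, rfl, ?_, hI.lt, ?_⟩
  -- After `N` rounds either the power has reached `N`, or all rounds increased the exponent, so `N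
  -- ≤ h < 4 ^ h`.
  · exact hI.le.elim id fun hle => hle.trans (Nat.lt_pow_self (by norm_num)).le
  · simp only [Function.update_self, ne_eq, Fin.reduceEq, not_false_eq_true,
      Function.update_of_ne, hI.r1, hI.r5, hI.r6, hI.r7, ← BitVec.ofNat_add, and_true, true_and]
    congr 1
    ring

end Setup

/-! ### From words to triangles and their weights -/

section Graph

variable {w N : ℕ} {G : SimpleGraph (Fin N)} {wt : Sym2 (Fin N) → ℤ}

theorem weightMatrix_isSome (i j : ℕ) :
    (weightMatrix G wt i j).isSome ↔ ∃ (hi : i < N) (hj : j < N), G.Adj ⟨i, hi⟩ ⟨j, hj⟩ := by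
  rw [weightMatrix]
  split_ifs with h <;> simp [h]

theorem weightMatrix_of_adj {i j : Fin N} (h : G.Adj i j) :
    weightMatrix G wt i j = some (wt s(i, j)) := by
  rw [weightMatrix, dif_pos ⟨i.2, j.2, h⟩]

theorem Tri.exists_isTriangle {v : BitVec w × BitVec w × BitVec w}
    (h : Tri (weightMatrix G wt) v) :
    ∃ i j k : Fin N, IsTriangle G i j k ∧
      v.1.toNat = i ∧ v.2.1.toNat = j ∧ v.2.2.toNat = k := by
  obtain ⟨h1, h2, h3⟩ := h
  rw [weightMatrix_isSome] at h1 h2 h3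
  obtain ⟨hi, hj, a1⟩ := h1
  obtain ⟨_, hk, a2⟩ := h2
  obtain ⟨_, _, a3⟩ := h3
  exact ⟨⟨_, hi⟩, ⟨_, hj⟩, ⟨_, hk⟩, ⟨a1, a2, a3⟩, rfl, rfl, rfl⟩

theorem tri_of_isTriangle {i j k : Fin N} (h : IsTriangle G i j k)
    {v : BitVec w × BitVec w × BitVec w} (h1 : v.1.toNat = i) (h2 : v.2.1.toNat = j)
    (h3 : v.2.2.toNat = k) : Tri (weightMatrix G wt) v := by
  obtain ⟨a1, a2, a3⟩ := h
  rw [Tri, h1, h2, h3, weightMatrix_of_adj a1, weightMatrix_of_adj a2, weightMatrix_of_adj a3]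
  exact ⟨rfl, rfl, rfl⟩

theorem abs_triangleWeight_le {M : ℕ} (hM : ∀ a ∈ G.edgeSet, |wt a| ≤ (M : ℤ)) {i j k : Fin N}
    (h : IsTriangle G i j k) : |triangleWeight wt i j k| ≤ 3 * M := by
  have h1 := abs_le.1 (hM _ ((SimpleGraph.mem_edgeSet G).2 h.1))
  have h2 := abs_le.1 (hM _ ((SimpleGraph.mem_edgeSet G).2 h.2.1))
  have h3 := abs_le.1 (hM _ ((SimpleGraph.mem_edgeSet G).2 h.2.2))
  rw [abs_le, triangleWeight]
  constructor <;> linarith [h1.1, h1.2, h2.1, h2.2, h3.1, h3.2]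

/-- The range covers all triangle weights and the initial threshold, so signed comparison of words
is comparison of integers. -/
theorem toInt_ofInt_of_abs_le {M : ℕ} (hMw : 6 * M + 2 < 2 ^ w) {z : ℤ} (hz : |z| ≤ 3 * M + 1) :
    (BitVec.ofInt w z).toInt = z := by
  have hw : 0 < w := by
    by_contra h0
    rw [Nat.eq_zero_of_not_pos h0] at hMw
    omega
  obtain ⟨y, rfl⟩ : ∃ y, w = y + 1 := ⟨w - 1, by omega⟩
  have hp : (6 * M + 2 : ℤ) < 2 * 2 ^ y := by
    rw [pow_succ] at hMw
    have : ((6 * M + 2 : ℕ) : ℤ) < ((2 ^ y * 2 : ℕ) : ℤ) := by exact_mod_cast hMw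
    push_cast at this
    linarith
  rw [abs_le] at hz
  refine BitVec.toInt_ofInt_eq_self hw ?_ ?_ <;> rw [Nat.add_sub_cancel] <;> linarith [hz.1, hz.2]

theorem toInt_weightWord {M : ℕ} (hM : ∀ a ∈ G.edgeSet, |wt a| ≤ (M : ℤ))
    (hMw : 6 * M + 2 < 2 ^ w) {i j k : Fin N} (h : IsTriangle G i j k)
    {v : BitVec w × BitVec w × BitVec w} (h1 : v.1.toNat = i) (h2 : v.2.1.toNat = j)
    (h3 : v.2.2.toNat = k) :
    (weightWord (weightMatrix G wt) v).toInt = triangleWeight wt i j k := by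
  have habs := abs_triangleWeight_le hM h
  obtain ⟨a1, a2, a3⟩ := h
  rw [weightWord]
  simp only [Op.eval]
  rw [h1, h2, h3, weightMatrix_of_adj a1, weightMatrix_of_adj a2, weightMatrix_of_adj a3]
  simp only [Option.getD_some]
  rw [← BitVec.ofInt_add, ← BitVec.ofInt_add]
  exact toInt_ofInt_of_abs_le hMw (by rw [triangleWeight] at habs; linarith)

/-- Padding values are not vertices, hence have no edges and are never marked. -/
theorem rank_le (thr : BitVec w) : rank (weightMatrix G wt) thr ≤ N ^ 3 := by
  classical
  have : N ^ 3 = (Finset.range N ×ˢ Finset.range N ×ˢ Finset.range N).card := by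
    simp only [Finset.card_product, Finset.card_range]
    ring
  rw [this, rank]
  refine Finset.card_le_card_of_injOn (fun v => (v.1.toNat, v.2.1.toNat, v.2.2.toNat)) ?_ ?_
  · intro v hv
    obtain ⟨i, j, k, -, h1, h2, h3⟩ := (show Marked _ _ _ by simpa using hv).1.exists_isTriangle
    simp [h1, h2, h3]
  · intro v _ v' _ h
    simp only [Prod.mk.injEq, BitVec.toNat_inj] at h
    exact Prod.ext h.1 (Prod.ext h.2.1 h.2.2)

/-- At rank zero no triangle is below the threshold. If the threshold is still `3 * M + 1`, no
triangle exists; otherwise it is the weight of the recorded triangle. -/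
theorem Ready.correct {M h : ℕ} (hM : ∀ a ∈ G.edgeSet, |wt a| ≤ (M : ℤ))
    (hMw : 6 * M + 2 < 2 ^ w) (hN : N < 2 ^ w) {s : Branch w 16 15}
    (hs : Ready (weightMatrix G wt) h (BitVec.ofNat w (3 * M + 1)) s)
    (hr : s.rank (weightMatrix G wt) = 0) : Correct (c := 12) G wt s := by
  classical
  have hmin : ∀ i j k, IsTriangle G i j k → (s.cl 4).toInt ≤ triangleWeight wt i j k := by
    intro i j k hT
    by_contra hlt
    have e : ∀ i : Fin N, (BitVec.ofNat w i).toNat = i := fun i => by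
      rw [BitVec.toNat_ofNat, Nat.mod_eq_of_lt (by omega)]
    have hm : Marked (weightMatrix G wt) (s.cl 4)
        (BitVec.ofNat w i, BitVec.ofNat w j, BitVec.ofNat w k) :=
      ⟨tri_of_isTriangle hT (e i) (e j) (e k),
        by rw [toInt_weightWord hM hMw hT (e i) (e j) (e k)]; exact not_le.1 hlt⟩
    rw [Branch.rank, QMachine.rank, Finset.card_eq_zero, Finset.filter_eq_empty_iff] at hr
    exact hr (Finset.mem_univ _) hm
  rcases hs.out with ⟨h0, h4⟩ | ⟨h0, hT, h4⟩
  · right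
    refine ⟨h0, fun i j k hT => ?_⟩
    have h1 := hmin i j k hT
    have h2 := (abs_le.1 (abs_triangleWeight_le hM hT)).2
    rw [h4, ← BitVec.ofInt_natCast, toInt_ofInt_of_abs_le hMw] at h1
    · push_cast at h1
      linarith
    · rw [abs_of_nonneg (by positivity)]
      push_cast
      exact le_rfl
  · left
    obtain ⟨i, j, k, hijk, h1, h2, h3⟩ := hT.exists_isTriangle
    refine ⟨h0, i, j, k, ⟨hijk, ?_⟩, h1, h2, h3⟩
    rw [h4, toInt_weightWord hM hMw hijk h1 h2 h3] at hmin
    exact hmin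

end Graph

/-! ### Numerical bounds and conclusion -/

section Final

theorem log_bound {N h : ℕ} (hN : 1 ≤ N) (h4 : 4 ^ h < 4 * N) :
    (h : ℝ) + 1 ≤ 2 * (1 + Real.log N) ∧ (8 : ℝ) ^ h ≤ 8 * (N : ℝ) ^ (3 / 2 : ℝ) := by
  have hN0 : (0 : ℝ) < N := by exact_mod_cast hN
  have h4' : (4 : ℝ) ^ h ≤ 4 * N := by exact_mod_cast h4.le
  have hlog4 : 1 ≤ Real.log 4 := by
    have := Real.log_two_gt_d9
    rw [show (4 : ℝ) = 2 ^ 2 by norm_num, Real.log_pow]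
    push_cast
    linarith
  have hlogN : 0 ≤ Real.log N := Real.log_nonneg (by exact_mod_cast hN)
  constructor
  · have h1 := Real.log_le_log (by positivity) h4'
    rw [Real.log_pow, Real.log_mul (by norm_num) hN0.ne'] at h1
    by_contra hlt
    rw [not_le] at hlt
    nlinarith
  · have e : ∀ x : ℝ, 0 ≤ x → x ^ (3 / 2 : ℝ) = Real.sqrt x ^ 3 := by
      intro x hx
      rw [Real.sqrt_eq_rpow, ← Real.rpow_natCast, ← Real.rpow_mul hx]
      norm_num
    have h2 : (8 : ℝ) ^ h = Real.sqrt (4 ^ h) ^ 3 := by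
      rw [show (4 : ℝ) ^ h = (2 ^ h) ^ 2 by rw [← pow_mul, mul_comm, pow_mul]; norm_num,
        Real.sqrt_sq (by positivity), ← pow_mul, mul_comm, pow_mul]
      norm_num
    have h3 : (8 : ℝ) * (N : ℝ) ^ (3 / 2 : ℝ) = Real.sqrt (4 * N) ^ 3 := by
      rw [e N hN0.le, Real.sqrt_mul (by norm_num), show (4 : ℝ) = 2 ^ 2 by norm_num,
        Real.sqrt_sq (by norm_num)]
      ring
    rw [h2, h3]
    gcongr

theorem time_bound {N h D : ℕ} (hN : N ≤ 4 ^ h) :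
    7 + 7 * N + (1 + D * (1 + 2 * h * (2 + 2 ^ (3 * h + 1) * (65 * (h + 1)) + 1) + 1)) ≤
      268 * (D + 1) * 8 ^ h * (h + 1) ^ 2 := by
  have h8 : 2 ^ (3 * h + 1) = 2 * 8 ^ h := by
    rw [pow_succ, pow_mul]; norm_num; ring
  have h48 : 4 ^ h ≤ 8 ^ h := Nat.pow_le_pow_left (by norm_num) h
  have h1 : 1 ≤ 8 ^ h := Nat.one_le_pow _ _ (by norm_num)
  rw [h8]
  generalize 8 ^ h = y at *
  have hNy : N ≤ y := hN.trans h48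
  have a1 : 1 + 2 * h * (2 + 2 * y * (65 * (h + 1)) + 1) + 1 ≤ 268 * y * (h + 1) ^ 2 := by
    nlinarith [Nat.mul_le_mul_right h h1, Nat.mul_le_mul_right (h ^ 2) h1, Nat.zero_le (y * h),
      Nat.zero_le (y * h ^ 2)]
  have a2 : 8 + 7 * N ≤ 268 * y * (h + 1) ^ 2 := by
    nlinarith [Nat.zero_le (y * h), Nat.zero_le (y * h ^ 2)]
  have a3 := Nat.mul_le_mul_left D a1
  calc _ ≤ D * (268 * y * (h + 1) ^ 2) + 268 * y * (h + 1) ^ 2 := by linarith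
    _ = _ := by ring

theorem error_bound {N h d r : ℕ} (hN : 1 ≤ N) (hNh : N ≤ 4 ^ h) (hr : r ≤ N ^ 3) :
    (((3 / 4 : ℝ) ^ (2 * h)) ^ (3 * (d + 3))) * r ≤ 1 / (N : ℝ) ^ d := by
  have hN0 : (0 : ℝ) < N := by exact_mod_cast hN
  have h1 : ((3 / 4 : ℝ) ^ (2 * h)) ^ (3 * (d + 3)) ≤ 1 / (N : ℝ) ^ (d + 3) := by
    calc ((3 / 4 : ℝ) ^ (2 * h)) ^ (3 * (d + 3)) = (((3 / 4 : ℝ) ^ 6) ^ h) ^ (d + 3) := by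
          rw [← pow_mul, ← pow_mul, ← pow_mul]; congr 1; ring
      -- Six sweeps reduce the expected rank by a factor of four, since `(3 / 4) ^ 6 < 1 / 4`; this
      -- fixes the factor `3` in `D`. Three of the `d + 3` powers of `N` pay for the initial rank.
      _ ≤ (((1 / 4 : ℝ)) ^ h) ^ (d + 3) := by
          gcongr
          norm_num
      _ = 1 / ((4 : ℝ) ^ h) ^ (d + 3) := by rw [one_div_pow, one_div_pow]
      _ ≤ _ := by
          gcongr
          exact_mod_cast hNh
  calc _ ≤ 1 / (N : ℝ) ^ (d + 3) * (N : ℝ) ^ 3 := by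
        gcongr
        exact_mod_cast hr
    _ = _ := by
        rw [pow_add]
        field_simp

theorem word_bounds {N M D w : ℕ} (hN : 1 ≤ N)
    (hw : (D + 10) * (Nat.size N + Nat.size M) ≤ w) :
    D < 2 ^ w ∧ 4 * N ≤ 2 ^ w ∧ 6 * M + 2 < 2 ^ w ∧ ∀ h, 4 ^ h < 4 * N → 3 * h + 2 ≤ w := by
  have hs : 1 ≤ Nat.size N := Nat.size_pos.2 hN
  -- The constant `D` must itself fit into a word; it is absorbed because `N` has at least one bit.
  have h1 : D + 10 * Nat.size N + 10 * Nat.size M ≤ w := by nlinarith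
  have hN' := Nat.lt_size_self N
  have hM' := Nat.lt_size_self M
  refine ⟨?_, ?_, ?_, fun h hh => ?_⟩
  · exact (show D ≤ w by omega).trans_lt Nat.lt_two_pow_self
  · calc 4 * N ≤ 2 ^ (Nat.size N + 2) := by rw [pow_add]; omega
      _ ≤ _ := Nat.pow_le_pow_right (by norm_num) (by omega)
  · calc 6 * M + 2 < 2 ^ (Nat.size M + 3) := by rw [pow_add]; omega
      _ ≤ _ := Nat.pow_le_pow_right (by norm_num) (by omega)
  · have : 2 ^ (2 * h) < 2 ^ (Nat.size N + 2) := by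
      rw [pow_mul, pow_add]
      norm_num
      omega
    have := (Nat.pow_lt_pow_iff_right (by norm_num)).1 this
    omega

end Final

end QMachine

open QMachine in
theorem mainTheorem8 (d : ℕ) :
    ∃ (c q : ℕ) (P : Prog (c + 4) q) (κ e : ℕ) (C : ℝ),
      ∀ (N : ℕ) (_ : 1 ≤ N) (M : ℕ) (G : SimpleGraph (Fin N)) (wt : Sym2 (Fin N) → ℤ)
        (_ : ∀ a ∈ G.edgeSet, |wt a| ≤ (M : ℤ)) (w : ℕ) (_ : κ * (Nat.size N + Nat.size M) ≤ w),
        (∀ s ∈ run (weightMatrix G wt) P (start w c q N M), s.prob ≠ 0 →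
          (s.time : ℝ) ≤ C * (N : ℝ) ^ (3 / 2 : ℝ) * (1 + Real.log N) ^ e) ∧
        1 - 1 / (N : ℝ) ^ d ≤
          probEvent (run (weightMatrix G wt) P (start w c q N M)) (Correct G wt) := by
  set D := 3 * (d + 3) with hD
  refine ⟨12, 15, minTriangle D, D + 10, 2, 268 * (D + 1) * 8 * 4, ?_⟩
  intro N hN M G wt hM w hw
  obtain ⟨hDw, hNw, hMw, hhw⟩ := word_bounds hN hw
  set W := weightMatrix G wt with hW
  obtain ⟨cl, h, hrun, hNh, hhN, h0, h4, h5, h6, h7⟩ := run_setup (W := W) (w := w) (N := N)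
    (M := M) hN hNw (cl := (start w 12 15 N M).cl) rfl rfl rfl rfl (start w 12 15 N M).psi 0
  have hh := hhw h hhN
  have hT : ∀ v : BitVec w × BitVec w × BitVec w, Tri W v → InBox (2 * h) v := by
    intro v hv
    obtain ⟨i, j, k, -, h1, h2, h3⟩ := hv.exists_isTriangle
    rw [InBox, h1, h2, h3, pow_mul]
    norm_num
    omega
  set s₀ : Branch w 16 15 := ⟨cl, (start w 12 15 N M).psi, 0 + (7 + 7 * N)⟩ with hs₀
  have hpsi : (start w 12 15 N M).psi = zeroState := rfl
  have hready : Ready W h (BitVec.ofNat w (3 * M + 1)) s₀ :=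
    ⟨h5, h6, h7, Or.inl ⟨h0, h4⟩, 1, by rw [hs₀, hpsi, one_smul]⟩
  have hprob : s₀.prob = 1 := by
    have := prob_smul_zeroState cl 1 (0 + (7 + 7 * N))
    rw [one_smul] at this
    simpa [hs₀, hpsi] using this
  have h2h : 2 * h < 2 ^ w := (show 2 * h ≤ w by omega).trans_lt Nat.lt_two_pow_self
  have hC := ((contracts_sweep (thr₀ := BitVec.ofNat w (3 * M + 1)) hh hT).loop (by norm_num)
    (a := .reg 5) (m := 2 * h) fun s hs => by
      rw [eval_reg, hs.r5, BitVec.toNat_ofNat, Nat.mod_eq_of_lt h2h]).loop (by positivity)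
    (a := .lit D) (m := D) fun s _ => by
      rw [eval_lit, BitVec.toNat_ofNat, Nat.mod_eq_of_lt hDw]
  have hall : run W (minTriangle D) (start w 12 15 N M) =
      run W (.loop (.lit D) (.loop (.reg 5) sweep)) s₀ := run_seq_of_run_eq hrun
  rw [hall]
  constructor
  · intro s hs _
    have ht := ((hC.ready s₀ hready s hs).2.trans (le_of_eq (by rw [hs₀, zero_add]))).trans
      (time_bound hNh)
    obtain ⟨b1, b2⟩ := log_bound hN hhN
    calc (s.time : ℝ) ≤ 268 * (D + 1) * 8 ^ h * (h + 1) ^ 2 := by exact_mod_cast ht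
      _ ≤ 268 * (D + 1) * (8 * (N : ℝ) ^ (3 / 2 : ℝ)) * (2 * (1 + Real.log N)) ^ 2 := by gcongr
      _ = _ := by ring
  · calc 1 - 1 / (N : ℝ) ^ d ≤ s₀.prob - ((3 / 4) ^ (2 * h)) ^ D * (s₀.prob * s₀.rank W) := by
          rw [hprob, one_mul]
          have he := error_bound (d := d) (r := s₀.rank W) hN hNh (rank_le (s₀.cl 4))
          rw [← hD] at he
          linarith
      _ ≤ total _ (fun s => s.prob - s.prob * s.rank W) := by
          rw [total_sub, hC.prob s₀ hready]
          linarith [hC.rank s₀ hready]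
      _ ≤ _ := by
          refine total_le_probEvent _ _ _ (fun s _ => ?_) fun s hs hs' => ?_
          · have := mul_nonneg s.prob_nonneg (Nat.cast_nonneg (α := ℝ) (s.rank W))
            linarith
          · have hr : s.rank W ≠ 0 := fun hr =>
              hs' ((hC.ready s₀ hready s hs).1.correct hM hMw (by omega) hr)
            -- An incorrect branch has rank at least one, because ranks are integers, so it
            -- contributes nothing positive.
            have : (1 : ℝ) ≤ s.rank W := by exact_mod_cast Nat.one_le_iff_ne_zero.2 hr
            nlinarith [s.prob_nonneg]
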